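/- **Conventions.** Trees are finite rooted planar trees. A vertex without children is a leaf, any other vertex is internal; vertices are listed in lexicographic (depth-first) order. $\mathbb T_k$ is the set of trees with $k$ vertices, $c_u(a)$ is the number of children of the vertex $u$ of $a$, and $c_i(a)$ is the number of children of its $i$-th vertex. A $\mu$-BGW tree is the random tree in which the numbers of children of the vertices are independent with law $\mu$. The reduced tree $R(a)$ is obtained from a tree $a$ (with at least one internal vertex) by removing all its leaves. If $a$ has $k$ internal vertices, then $R(a)\in\mathbb T_k$, and the $j$-th vertex of $R(a)$ has $c_j(R(a))+1$ corners (ordered from left to right), so there are $2k-1$ corners in total; they are listed by visiting the vertices of $R(a)$ in lexicographic order. The sequence of leaves $L(a)=(L_1(a),\dots,L_{2k-1}(a))$ is defined as follows: $L_i(a)$ is the number of leaves of $a$ grafted in the $i$-th corner of $R(a)$ if this corner belongs to an internal vertex of $R(a)$, and that number minus one if it belongs to a leaf of $R(a)$. A composition of $N\ge 0$ into $m$ parts is an element $(\ell_1,\dots,\ell_m)$ of $\mathbb Z_{\ge0}^m$ with $\ell_1+\dots+\ell_m=N$. **Theorem.** Let $\mu$ be a probability distribution on $\mathbb Z_{\ge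 0}$ whose generating function $F_\mu(z)=\sum_{n\ge0}\mu(n)z^n$ satisfies, for $|z|\le 1$, $$F_\mu(z)=c\exp(P(z)),\qquad c>0,\quad P(z)=\sum_{i=1}^p a_iz^i,\quad a_i\ge 0,\quad \gcd\{j: a_j\ne0\}=1 .$$ Fix $k\ge 1$. For all large $n$ a $\mu$-BGW tree has exactly $n$ vertices and $k$ internal vertices with positive probability; let $T_{n,k}$ be a $\mu$-BGW tree conditioned on this event, whenever its probability is positive, and let $X^n_i$ be the number of children of the $i$-th internal vertex of $T_{n,k}$. 1. For every $a\in\mathbb T_k$, $$\mathbb P(R(T_{n,k})=a)\xrightarrow[n\to\infty]{}\frac{\zeta_k(a)}{\sum_{b\in\mathbb T_k}\zeta_k(b)},\qquad \zeta_k(a)=\prod_{u\in a}\frac1{c_u(a)!},$$ and the limit is the probability that a BGW tree with offspring distribution Poisson$(1)$, conditioned to have $k$ vertices, is equal to $a$. 2. $\frac1n(X^n_1,\dots,X^n_k)\to(\frac1k,\dots,\frac1k)$ in probability as $n\to\infty$, jointly with the convergence in 1; that is, for all $a\in\mathbb T_k$ and $\varepsilon>0$, the probability that $R(T_{n,k})=a$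 and $|X^n_i/n-1/k|<\varepsilon$ for all $i\le k$ converges to $\zeta_k(a)/\sum_{b\in\mathbb T_k}\zeta_k(b)$. 3. For every $n$, conditionally given $R(T_{n,k})=a$ and $(X^n_1,\dots,X^n_k)$ (for any values taken with positive probability), for every $i\in\{1,\dots,k\}$ the vector $(L_{s_i+1}(T_{n,k}),\dots,L_{s_i+c_i(a)+1}(T_{n,k}))$, where $s_i=\sum_{j<i}(c_j(a)+1)$, is a uniformly random composition of $$X^n_i-\max(c_i(a),1)=n-1-\sum_{j\ne i}X^n_j-\max(c_i(a),1)$$ into $c_i(a)+1$ parts. -/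

import Mathlib

open MeasureTheory ProbabilityTheory Filter Topology

/-- Finite rooted planar (ordered) trees: a tree is its root together with the ordered list of the
subtrees hanging from the children of the root. -/
inductive PlaneTree : Type where
  | node (children : List PlaneTree) : PlaneTree

namespace PlaneTree

/-- The ordered list of the subtrees hanging from the children of the root. -/
def children : PlaneTree → List PlaneTree
  | node l => l

/-- The tree consists of its root only. Applied to the subtree hanging from a vertex, it says that
this vertex is a leaf. -/
def isLeaf (t : PlaneTree) : Bool := t.children.isEmpty

/-- The subtree of `t` hanging from the vertex with address `u`, if `u` is the address of a vertex
of `t`. The address of the root is the empty word; the `i`-th child (`i = 0, 1, …`) of the vertex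
with address `v` has the address `v ++ [i]`. -/
def subtreeAt : PlaneTree → List ℕ → Option PlaneTree
  | t, [] => some t
  | t, i :: u => (t.children[i]?).bind fun s => subtreeAt s u

/-- The set of the addresses of the vertices of a finite tree. -/
def vertices (t : PlaneTree) : Set (List ℕ) := {u | (t.subtreeAt u).isSome}

/-- The numbers of children of all the vertices, in lexicographic (depth-first) order. -/
def degrees : PlaneTree → List ℕ
  | node l => l.length :: l.flatMap fun t => degrees t

/-- The number of vertices `|t|`. -/
def numVertices (t : PlaneTree) : ℕ := t.degrees.length

/-- The numbers of children of the internal (that is, non-leaf) vertices, in lexicographic order. -/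
def internalDegrees (t : PlaneTree) : List ℕ := t.degrees.filter (· ≠ 0)

/-- The number of internal vertices. -/
def numInternal (t : PlaneTree) : ℕ := t.internalDegrees.length

/-- The number of children of the `i`-th vertex (`i = 0, 1, …`) in lexicographic order. -/
def degree (t : PlaneTree) (i : ℕ) : ℕ := t.degrees.getD i 0

/-- The number of children of the `i`-th internal vertex (`i = 0, 1, …`) in lexicographic order. -/
def internalDegree (t : PlaneTree) (i : ℕ) : ℕ := t.internalDegrees.getD i 0

/-- The reduced tree `R(t)`: all the leaves of `t` are removed (the root is kept by convention when
`t` is a single vertex). -/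
def reduced : PlaneTree → PlaneTree
  | node l => node (l.flatMap fun t => if t.isLeaf then [] else [reduced t])

/-- The numbers of leaves grafted in the successive corners of an internal vertex whose children
carry the subtrees `l`: the children that are internal vertices cut the row of the children into
runs of leaves, and the lengths of these runs are listed. If there is only one corner (the vertex
becomes a leaf of the reduced tree), then this number is diminished by one. -/
def cornerCounts (l : List PlaneTree) : List ℕ :=
  if l.all isLeaf then [l.length - 1]
  else (l.splitOnP fun t => !t.isLeaf).map List.length

/-- The sequence of leaves `L(t)`: the internal vertices are visited in lexicographic order, the
corners of each of them from left to right. -/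
def leafSeq : PlaneTree → List ℕ
  | node l => if l.isEmpty then [] else cornerCounts l ++ l.flatMap fun t => leafSeq t

/-- The part of the sequence of leaves `L(t)` that belongs to the corners of the `i`-th vertex
(`i = 0, 1, …`) of the reduced tree, when the reduced tree is `a`: the `j`-th vertex of `a` has
`a.degree j + 1` corners. -/
def leafBlock (a : PlaneTree) (i : ℕ) (t : PlaneTree) : Fin (a.degree i + 1) → ℕ :=
  fun m => t.leafSeq.getD ((∑ j ∈ Finset.range i, (a.degree j + 1)) + m) 0

/-- The weight `ζ(t) = 1 / ∏ c_u(t)!`, the product over all the vertices `u` of `t`. -/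
noncomputable def zeta (t : PlaneTree) : ℝ := ((t.degrees.map Nat.factorial).prod : ℝ)⁻¹

instance : MeasurableSpace PlaneTree := ⊤

theorem numVertices_node (l : List PlaneTree) :
    (node l).numVertices = 1 + (l.map numVertices).sum := by
  simp only [numVertices, degrees, List.length_cons, List.length_flatMap]
  rw [Nat.add_comm]
  rfl

theorem numVertices_pos (t : PlaneTree) : 0 < t.numVertices := by
  obtain ⟨l⟩ := t
  rw [numVertices_node]
  omega

theorem length_le_sum (l : List PlaneTree) : l.length ≤ (l.map numVertices).sum := by
  induction l with
  | nil => simp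
  | cons t l ih =>
    have := t.numVertices_pos
    simp only [List.length_cons, List.map_cons, List.sum_cons]
    omega

theorem finite_numVertices_le (k : ℕ) : {t : PlaneTree | t.numVertices ≤ k}.Finite := by
  induction k with
  | zero =>
    convert Set.finite_empty (α := PlaneTree)
    ext t
    have := t.numVertices_pos
    simp only [Set.mem_ofPred_eq, Set.mem_empty_iff_false, iff_false]
    omega
  | succ k ih =>
    have : Finite {t : PlaneTree | t.numVertices ≤ k} := ih
    refine Set.Finite.subset ((List.finite_length_le {t : PlaneTree | t.numVertices ≤ k} k).image
      fun l => node (l.map Subtype.val)) ?_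
    rintro ⟨l⟩ hl
    rw [Set.mem_ofPred_eq, numVertices_node] at hl
    have hlen := length_le_sum l
    have hmem : ∀ t ∈ l, t.numVertices ≤ k := fun t ht => by
      have := List.single_le_sum (l := l.map numVertices) (fun _ _ => Nat.zero_le _) _
        (List.mem_map_of_mem ht)
      omega
    refine ⟨l.pmap Subtype.mk hmem, ?_, ?_⟩
    · simp only [Set.mem_ofPred_eq, List.length_pmap]
      omega
    · simp [List.map_pmap]

/-- The finite set `𝕋_k` of the trees with `k` vertices. -/
noncomputable def treesOfSize (k : ℕ) : Finset PlaneTree :=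
  ((finite_numVertices_le k).subset
    (fun _ h => le_of_eq h : {t : PlaneTree | t.numVertices = k} ⊆ _)).toFinset

theorem mem_treesOfSize {k : ℕ} {t : PlaneTree} : t ∈ treesOfSize k ↔ t.numVertices = k := by
  simp [treesOfSize]

end PlaneTree

/-- The (possibly infinite) tree in which every vertex `u` has `c u` children, as the set of the
addresses of its vertices. -/
def familyTree (c : List ℕ → ℕ) : Set (List ℕ) := {u | ∀ v j, v ++ [j] <+: u → j < c v}

/-- The law, on finite trees, of a Bienaymé–Galton–Watson tree `T` with offspring distribution `μ`:
the tree `τ` receives the mass `ℙ(T = τ)`, where `T` is the family tree of independent random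
variables `(c u)`, indexed by the words `u`, all with the law `μ`. The total mass is `ℙ(T is finite)`. -/
noncomputable def bgwLaw (μ : Measure ℕ) : Measure PlaneTree :=
  Measure.sum fun τ : PlaneTree =>
    Measure.infinitePi (fun _ : List ℕ => μ) {c | familyTree c = τ.vertices} • Measure.dirac τ

/-- The law of `T_{n,k}`: a BGW tree with offspring distribution `μ` conditioned to have `n`
vertices and `k` internal vertices. -/
noncomputable def bgwCond (μ : Measure ℕ) (n k : ℕ) : Measure PlaneTree :=
  (bgwLaw μ)[|{t | t.numVertices = n ∧ t.numInternal = k}]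

/-- The law of a BGW tree with offspring distribution `μ` conditioned to have `k` vertices. -/
noncomputable def bgwCondSize (μ : Measure ℕ) (k : ℕ) : Measure PlaneTree :=
  (bgwLaw μ)[|{t | t.numVertices = k}]

/-- The generating function `F_μ`. -/
noncomputable def genFun (μ : Measure ℕ) (z : ℂ) : ℂ := ∑' n : ℕ, (μ.real {n} : ℂ) * z ^ n

/-! ### Decomposition of a tree into its reduced tree and its blocks of leaves -/

namespace PlaneTree

/-! A tree with an internal vertex amounts to its reduced tree `a` together with one block of
`c_i(a) + 1` nonnegative integers for each vertex of `a`, and these blocks are arbitrary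
(`ext_of_reduced_of_leafBlocks`, `exists_reduced_leafBlocks`). The `i`-th internal vertex has `max
(c_i) 1` plus the sum of its block as number of children, so stars and bars gives `∏ C(x_i, c_i)`
trees with reduced tree `a` and internal degrees `x_i ≥ 1` (`ncard_treesOver`, `card_blockFinset`).
All these trees have the same mass `μ(0)^(n-k) ∏ μ(x_i)`, where `n = 1 + ∑ x_i`
(`bgwLaw_of_subset_treesOver`). Hence each block is uniform given `a` and `x`, for every `n`.

Consequently the joint law of reduced tree and internal degrees is that of `k` i.i.d. variables of
law `μ` conditioned to have sum `n - 1`, reweighted by the number of trees. The degrees of `a` add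
up to `k - 1`, so this number divided by `n^(k-1)` is at most `1`, and it tends to `(1/k)^(k-1)
ζ(a)` when all the `x_i / n` tend to `1/k` (`tendsto_treeCount_div`). The normalizations do not
depend on `a` and cancel, so everything reduces to the concentration of the conditioned i.i.d.
variables.

Concentration follows from `θF = (θP) F` with `θ = z d/dz`. The first two conditional moments become
coefficients of products with `F^k`; the mean is exactly `(n-1)/k`, and the variance is of order `n`
because `θ²P ≤ p θP` coefficientwise (`sum_piAntidiag_prod_coeff_mul_sq_le`). A Chebyshev argument
then passes to the limit (`tendsto_condMean`). The gcd condition ensures that the conditioning has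
positive weight for large `n` (`eventually_coeff_pos`). -/

theorem induction_on_children {motive : PlaneTree → Prop}
    (h : ∀ l : List PlaneTree, (∀ t ∈ l, motive t) → motive (node l)) (t : PlaneTree) :
    motive t := by
  obtain ⟨l⟩ := t
  exact h l fun t _ => induction_on_children h t

theorem isLeaf_node (l : List PlaneTree) : (node l).isLeaf = l.isEmpty := rfl

theorem isLeaf_iff {t : PlaneTree} : t.isLeaf = true ↔ t = node [] := by
  obtain ⟨l⟩ := t
  simp [isLeaf_node]

/-- The internal vertices among the roots of a forest. -/
def nonLeaves (l : List PlaneTree) : List PlaneTree := l.filter fun t => !t.isLeaf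

theorem mem_nonLeaves {l : List PlaneTree} {t : PlaneTree} :
    t ∈ nonLeaves l ↔ t ∈ l ∧ t.isLeaf = false := by
  simp [nonLeaves]

theorem nonLeaves_cons_leaf (l : List PlaneTree) :
    nonLeaves (node [] :: l) = nonLeaves l := by
  simp [nonLeaves, isLeaf]
  rfl

theorem nonLeaves_cons_of_not_isLeaf {t : PlaneTree} (ht : t.isLeaf = false)
    (l : List PlaneTree) : nonLeaves (t :: l) = t :: nonLeaves l := by
  simp [nonLeaves, ht]

theorem nonLeaves_eq_nil_iff {l : List PlaneTree} : nonLeaves l = [] ↔ l.all isLeaf = true := by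
  simp [nonLeaves]

/-- Statistics that are empty on a leaf can be collected over the internal children only, which is
the recursion followed by `reduced`. -/
theorem flatMap_nonLeaves {α : Type*} {f : PlaneTree → List α} (hf : f (node []) = [])
    (l : List PlaneTree) : (nonLeaves l).flatMap f = l.flatMap f := by
  induction l with
  | nil => rfl
  | cons t l ih =>
    cases h : t.isLeaf
    · rw [nonLeaves_cons_of_not_isLeaf h, List.flatMap_cons, List.flatMap_cons, ih]
    · rw [isLeaf_iff.1 h, nonLeaves_cons_leaf, List.flatMap_cons, hf, ih, List.nil_append]

/-- The lengths of the runs of leaves among the roots of a forest. -/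
def leafRuns (l : List PlaneTree) : List ℕ := (l.splitOnP fun t => !t.isLeaf).map List.length

theorem leafRuns_nil : leafRuns [] = [0] := by simp [leafRuns]

theorem leafRuns_ne_nil (l : List PlaneTree) : leafRuns l ≠ [] := by
  simp [leafRuns, List.splitOnP_ne_nil]

theorem leafRuns_cons_leaf (l : List PlaneTree) :
    leafRuns (node [] :: l) = (leafRuns l).modifyHead (· + 1) := by
  rw [leafRuns, List.splitOnP_cons_eq_if_modifyHead, leafRuns]
  obtain ⟨b, bs, h⟩ := List.exists_cons_of_ne_nil
    (List.splitOnP_ne_nil (fun t : PlaneTree => !t.isLeaf) l)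
  simp [h, isLeaf_node]

theorem leafRuns_cons_of_not_isLeaf {t : PlaneTree} (ht : t.isLeaf = false)
    (l : List PlaneTree) : leafRuns (t :: l) = 0 :: leafRuns l := by
  rw [leafRuns, List.splitOnP_cons_eq_if_modifyHead, leafRuns]
  simp [ht]

theorem length_leafRuns (l : List PlaneTree) :
    (leafRuns l).length = (nonLeaves l).length + 1 := by
  induction l with
  | nil => simp [leafRuns_nil, nonLeaves]
  | cons t l ih =>
    cases h : t.isLeaf
    · simp [nonLeaves_cons_of_not_isLeaf h, leafRuns_cons_of_not_isLeaf h, ih]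
    · rw [isLeaf_iff.1 h, nonLeaves_cons_leaf, leafRuns_cons_leaf, List.length_modifyHead, ih]

theorem sum_leafRuns (l : List PlaneTree) :
    (nonLeaves l).length + (leafRuns l).sum = l.length := by
  induction l with
  | nil => simp [leafRuns_nil, nonLeaves]
  | cons t l ih =>
    cases h : t.isLeaf
    · simp [nonLeaves_cons_of_not_isLeaf h, leafRuns_cons_of_not_isLeaf h]
      omega
    · rw [isLeaf_iff.1 h, nonLeaves_cons_leaf, leafRuns_cons_leaf]
      obtain ⟨b, bs, hb⟩ := List.exists_cons_of_ne_nil (leafRuns_ne_nil l)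
      simp only [hb, List.sum_cons, List.modifyHead_cons, List.length_cons] at ih ⊢
      omega

/-- The head of the list of runs tells whether a nonempty row starts with a leaf (positive) or with
an internal vertex (zero), so the row can be read off from left to right; the total length detects
the empty row. -/
theorem ext_of_leafRuns_of_nonLeaves {l l' : List PlaneTree} (hr : leafRuns l = leafRuns l')
    (hn : nonLeaves l = nonLeaves l') : l = l' := by
  induction l generalizing l' with
  | nil =>
    have h := sum_leafRuns l'
    rw [← hr, ← hn, sum_leafRuns] at h
    exact (List.eq_nil_of_length_eq_zero h.symm).symm
  | cons t l ih =>
    cases l' with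
    | nil =>
      have h := sum_leafRuns (t :: l)
      rw [hr, hn, sum_leafRuns] at h
      simp at h
    | cons t' l' =>
      obtain ⟨b, bs, hb⟩ := List.exists_cons_of_ne_nil (leafRuns_ne_nil l)
      obtain ⟨b', bs', hb'⟩ := List.exists_cons_of_ne_nil (leafRuns_ne_nil l')
      cases h : t.isLeaf <;> cases h' : t'.isLeaf
      · rw [nonLeaves_cons_of_not_isLeaf h, nonLeaves_cons_of_not_isLeaf h'] at hn
        rw [leafRuns_cons_of_not_isLeaf h, leafRuns_cons_of_not_isLeaf h'] at hr
        rw [ih (List.cons.inj hr).2 (List.cons.inj hn).2, (List.cons.inj hn).1]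
      · rw [isLeaf_iff.1 h', leafRuns_cons_leaf, leafRuns_cons_of_not_isLeaf h, hb'] at hr
        simp at hr
      · rw [isLeaf_iff.1 h, leafRuns_cons_leaf, leafRuns_cons_of_not_isLeaf h', hb] at hr
        simp at hr
      · rw [isLeaf_iff.1 h, isLeaf_iff.1 h'] at hn hr ⊢
        rw [nonLeaves_cons_leaf, nonLeaves_cons_leaf] at hn
        rw [leafRuns_cons_leaf, leafRuns_cons_leaf, hb, hb'] at hr
        simp only [List.modifyHead_cons, List.cons.injEq, Nat.add_right_cancel_iff] at hr
        rw [ih (by rw [hb, hb', hr.1, hr.2]) hn]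

theorem exists_leafRuns_nonLeaves (b : List ℕ) (l' : List PlaneTree)
    (hb : b.length = l'.length + 1) (hl' : ∀ t ∈ l', t.isLeaf = false) :
    ∃ l, leafRuns l = b ∧ nonLeaves l = l' := by
  -- An empty first run is filled by putting `m` leaves in front.
  have key : ∀ (m : ℕ) (bs : List ℕ) (l' l : List PlaneTree), leafRuns l = 0 :: bs →
      nonLeaves l = l' → ∃ l, leafRuns l = m :: bs ∧ nonLeaves l = l' := by
    intro m bs l' l h1 h2
    induction m with
    | zero => exact ⟨l, h1, h2⟩
    | succ m ih =>
      obtain ⟨l, h1, h2⟩ := ih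
      exact ⟨node [] :: l, by rw [leafRuns_cons_leaf, h1]; rfl, by rw [nonLeaves_cons_leaf, h2]⟩
  induction l' generalizing b with
  | nil =>
    obtain ⟨m, rfl⟩ := List.length_eq_one_iff.1 hb
    exact key m [] [] [] leafRuns_nil rfl
  | cons t l' ih =>
    cases b with
    | nil => simp at hb
    | cons m bs =>
      obtain ⟨l, h1, h2⟩ := ih bs (by simpa using hb) fun s hs => hl' s (List.mem_cons_of_mem _ hs)
      have ht := hl' t List.mem_cons_self
      exact key m bs (t :: l') (t :: l) (by rw [leafRuns_cons_of_not_isLeaf ht, h1])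
        (by rw [nonLeaves_cons_of_not_isLeaf ht, h2])

theorem leafRuns_of_nonLeaves_eq_nil {l : List PlaneTree} (h : nonLeaves l = []) :
    leafRuns l = [l.length] := by
  have h1 := length_leafRuns l
  have h2 := sum_leafRuns l
  rw [h] at h1 h2
  obtain ⟨m, hm⟩ := List.length_eq_one_iff.1 h1
  rw [hm] at h2 ⊢
  simp at h2
  rw [h2]

theorem cornerCounts_of_nonLeaves_eq_nil {l : List PlaneTree} (h : nonLeaves l = []) :
    cornerCounts l = [l.length - 1] := by
  rw [cornerCounts, if_pos (nonLeaves_eq_nil_iff.1 h)]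

theorem cornerCounts_of_nonLeaves_ne_nil {l : List PlaneTree} (h : nonLeaves l ≠ []) :
    cornerCounts l = leafRuns l := by
  rw [cornerCounts, if_neg (fun h' => h (nonLeaves_eq_nil_iff.2 h')), leafRuns]

theorem length_cornerCounts (l : List PlaneTree) :
    (cornerCounts l).length = (nonLeaves l).length + 1 := by
  by_cases h : nonLeaves l = []
  · rw [cornerCounts_of_nonLeaves_eq_nil h, h]; rfl
  · rw [cornerCounts_of_nonLeaves_ne_nil h, length_leafRuns]

/-- The `max` absorbs the convention for a single corner: there no child is internal, but one leaf
has been discounted. -/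
theorem sum_cornerCounts {l : List PlaneTree} (hl : l ≠ []) :
    max (nonLeaves l).length 1 + (cornerCounts l).sum = l.length := by
  have := List.length_pos_iff.2 hl
  by_cases h : nonLeaves l = []
  · rw [cornerCounts_of_nonLeaves_eq_nil h, h]
    simp
    omega
  · rw [cornerCounts_of_nonLeaves_ne_nil h, max_eq_left (List.length_pos_iff.2 h), sum_leafRuns]

theorem ext_of_cornerCounts_of_nonLeaves {l l' : List PlaneTree} (hl : l ≠ []) (hl' : l' ≠ [])
    (hc : cornerCounts l = cornerCounts l') (hn : nonLeaves l = nonLeaves l') : l = l' := by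
  refine ext_of_leafRuns_of_nonLeaves ?_ hn
  by_cases h : nonLeaves l = []
  · have h1 := sum_cornerCounts hl
    rw [hc, hn, sum_cornerCounts hl'] at h1
    rw [leafRuns_of_nonLeaves_eq_nil h, leafRuns_of_nonLeaves_eq_nil (hn ▸ h), h1]
  · rwa [cornerCounts_of_nonLeaves_ne_nil h, cornerCounts_of_nonLeaves_ne_nil (hn ▸ h)] at hc

theorem exists_cornerCounts_nonLeaves (b : List ℕ) (l' : List PlaneTree)
    (hb : b.length = l'.length + 1) (hl' : ∀ t ∈ l', t.isLeaf = false) :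
    ∃ l, l ≠ [] ∧ cornerCounts l = b ∧ nonLeaves l = l' := by
  by_cases h : l' = []
  · subst h
    obtain ⟨m, rfl⟩ := List.length_eq_one_iff.1 hb
    -- A single corner records one leaf less than its run, hence `m + 1`.
    obtain ⟨l, h1, h2⟩ := exists_leafRuns_nonLeaves [m + 1] [] rfl (by simp)
    have h3 := leafRuns_of_nonLeaves_eq_nil h2
    rw [h1] at h3
    simp only [List.cons.injEq, and_true] at h3
    refine ⟨l, ?_, ?_, h2⟩
    · rintro rfl
      simp at h3
    · rw [cornerCounts_of_nonLeaves_eq_nil h2, ← h3]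
      rfl
  · obtain ⟨l, h1, h2⟩ := exists_leafRuns_nonLeaves b l' hb hl'
    refine ⟨l, ?_, ?_, h2⟩
    · rintro rfl
      exact h h2.symm
    · rw [cornerCounts_of_nonLeaves_ne_nil (h2 ▸ h), h1]

theorem reduced_node (l : List PlaneTree) :
    (node l).reduced = node ((nonLeaves l).map reduced) := by
  rw [reduced]
  congr 1
  induction l with
  | nil => rfl
  | cons t l ih =>
    cases h : t.isLeaf
    · rw [nonLeaves_cons_of_not_isLeaf h, List.flatMap_cons, ih]
      simp [h]
    · rw [isLeaf_iff.1 h, nonLeaves_cons_leaf, List.flatMap_cons, ih]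
      simp [isLeaf_node]

theorem degrees_node (l : List PlaneTree) :
    (node l).degrees = l.length :: l.flatMap degrees := by
  rw [degrees]

/-- The numbers of leaves grafted in the corners (see `cornerCounts`) of the successive internal
vertices, one block for each of these vertices. -/
def leafBlocks : PlaneTree → List (List ℕ)
  | node l => if l.isEmpty then [] else cornerCounts l :: l.flatMap fun t => leafBlocks t

theorem leafBlocks_leaf : leafBlocks (node []) = [] := by simp [leafBlocks]

theorem leafBlocks_node {l : List PlaneTree} (hl : l ≠ []) :
    leafBlocks (node l) = cornerCounts l :: (nonLeaves l).flatMap leafBlocks := by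
  rw [flatMap_nonLeaves leafBlocks_leaf, leafBlocks, if_neg (by simpa using hl)]

theorem leafSeq_eq_flatten (t : PlaneTree) : t.leafSeq = t.leafBlocks.flatten := by
  induction t using induction_on_children with
  | h l ih =>
    rw [leafSeq, leafBlocks]
    split_ifs
    · rfl
    · rw [List.flatten_cons, List.flatMap_def, List.flatMap_def, List.map_congr_left ih,
        List.flatten_flatten, List.map_map]
      rfl

theorem internalDegrees_leaf : internalDegrees (node []) = [] := by
  simp [internalDegrees, degrees_node]

theorem internalDegrees_node {l : List PlaneTree} (hl : l ≠ []) :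
    internalDegrees (node l) = l.length :: (nonLeaves l).flatMap internalDegrees := by
  rw [flatMap_nonLeaves internalDegrees_leaf, internalDegrees, degrees_node,
    List.filter_cons_of_pos (by simpa using hl), List.filter_flatMap]
  rfl

theorem forall₂_flatMap {α β γ : Type*} {R : β → γ → Prop} {f : α → List β} {g : α → List γ}
    {l : List α} (h : ∀ t ∈ l, List.Forall₂ R (f t) (g t)) :
    List.Forall₂ R (l.flatMap f) (l.flatMap g) := by
  induction l with
  | nil => exact .nil
  | cons t l ih =>
    exact List.rel_append (h t List.mem_cons_self) (ih fun s hs => h s (List.mem_cons_of_mem _ hs))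

theorem forall₂_degrees_leafBlocks {t : PlaneTree} (ht : t.isLeaf = false) :
    List.Forall₂ (fun c b => b.length = c + 1) t.reduced.degrees t.leafBlocks := by
  induction t using induction_on_children with
  | h l ih =>
    rw [isLeaf_node, List.isEmpty_eq_false_iff] at ht
    rw [leafBlocks_node ht, reduced_node, degrees_node, List.length_map, List.flatMap_map]
    refine .cons (length_cornerCounts l) (forall₂_flatMap fun t ht => ?_)
    rw [mem_nonLeaves] at ht
    exact ih t ht.1 ht.2

theorem zipWith_flatMap {α β γ δ : Type*} (φ : β → γ → δ) {f : α → List β} {g : α → List γ}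
    {l : List α} (h : ∀ t ∈ l, (f t).length = (g t).length) :
    List.zipWith φ (l.flatMap f) (l.flatMap g) = l.flatMap fun t => List.zipWith φ (f t) (g t) := by
  induction l with
  | nil => rfl
  | cons t l ih =>
    simp only [List.flatMap_cons]
    rw [List.zipWith_append (h t List.mem_cons_self), ih fun s hs => h s (List.mem_cons_of_mem _ hs)]

theorem internalDegrees_eq_zipWith {t : PlaneTree} (ht : t.isLeaf = false) :
    t.internalDegrees =
      List.zipWith (fun c b => max c 1 + b.sum) t.reduced.degrees t.leafBlocks := by
  induction t using induction_on_children with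
  | h l ih =>
    rw [isLeaf_node, List.isEmpty_eq_false_iff] at ht
    rw [leafBlocks_node ht, reduced_node, degrees_node, List.length_map, List.flatMap_map,
      internalDegrees_node ht, List.zipWith_cons_cons, sum_cornerCounts ht, zipWith_flatMap]
    · congr 1
      rw [List.flatMap_def, List.flatMap_def]
      congr 1
      refine List.map_congr_left fun t ht => ?_
      rw [mem_nonLeaves] at ht
      exact ih t ht.1 ht.2
    · intro t ht
      rw [mem_nonLeaves] at ht
      exact (forall₂_degrees_leafBlocks ht.2).length_eq

theorem length_leafBlocks {t : PlaneTree} (ht : t.isLeaf = false) :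
    t.leafBlocks.length = t.reduced.numVertices :=
  (forall₂_degrees_leafBlocks ht).length_eq.symm

theorem numInternal_eq_numVertices_reduced {t : PlaneTree} (ht : t.isLeaf = false) :
    t.numInternal = t.reduced.numVertices := by
  rw [numInternal, internalDegrees_eq_zipWith ht, List.length_zipWith, length_leafBlocks ht,
    numVertices, min_self]

theorem numInternal_eq_zero_of_isLeaf {t : PlaneTree} (ht : t.isLeaf = true) :
    t.numInternal = 0 := by
  rw [isLeaf_iff.1 ht, numInternal, internalDegrees_leaf, List.length_nil]

/-- The reduced tree fixes how many blocks each subtree owns, so the depth-first list of blocks can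
be cut back into the lists of the subtrees and the induction applies to each of them. -/
theorem ext_of_reduced_of_leafBlocks {t t' : PlaneTree} (ht : t.isLeaf = false)
    (ht' : t'.isLeaf = false) (hr : t.reduced = t'.reduced) (hb : t.leafBlocks = t'.leafBlocks) :
    t = t' := by
  induction t using induction_on_children generalizing t' with
  | h l ih =>
    obtain ⟨l'⟩ := t'
    rw [isLeaf_node, List.isEmpty_eq_false_iff] at ht ht'
    rw [leafBlocks_node ht, leafBlocks_node ht', List.cons.injEq] at hb
    rw [reduced_node, reduced_node, node.injEq] at hr
    obtain ⟨hc, hb⟩ := hb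
    congr 1
    refine ext_of_cornerCounts_of_nonLeaves ht ht' hc ?_
    have h1 : ∀ t ∈ nonLeaves l, t.isLeaf = false ∧ ∀ t' : PlaneTree, t'.isLeaf = false →
        t.reduced = t'.reduced → t.leafBlocks = t'.leafBlocks → t = t' := fun t h =>
      ⟨(mem_nonLeaves.1 h).2, fun t' => ih t (mem_nonLeaves.1 h).1 (mem_nonLeaves.1 h).2⟩
    have h2 : ∀ t ∈ nonLeaves l', t.isLeaf = false := fun t h => (mem_nonLeaves.1 h).2
    -- Only the two rows of internal children matter from here on; they are generalized to run a
    -- simultaneous induction on both.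
    clear hc ih
    generalize nonLeaves l = m at *
    generalize nonLeaves l' = m' at *
    induction m generalizing m' with
    | nil =>
      cases m' with
      | nil => rfl
      | cons t' m' => simp at hr
    | cons t m IH =>
      cases m' with
      | nil => simp at hr
      | cons t' m' =>
        simp only [List.map_cons, List.cons.injEq, List.flatMap_cons] at hr hb
        obtain ⟨h3, h4⟩ := h1 t List.mem_cons_self
        have h5 := h2 t' List.mem_cons_self
        have h6 := List.append_inj hb (by rw [length_leafBlocks h3, length_leafBlocks h5, hr.1])
        rw [h4 t' h5 hr.1 h6.1, IH (fun s hs => h1 s (List.mem_cons_of_mem _ hs)) _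
          (fun s hs => h2 s (List.mem_cons_of_mem _ hs)) hr.2 h6.2]

theorem exists_reduced_leafBlocks (a : PlaneTree) (B : List (List ℕ))
    (hB : List.Forall₂ (fun c b => b.length = c + 1) a.degrees B) :
    ∃ t : PlaneTree, t.isLeaf = false ∧ t.reduced = a ∧ t.leafBlocks = B := by
  induction a using induction_on_children generalizing B with
  | h l ih =>
    rw [degrees_node] at hB
    cases hB with
    | @cons _ b _ Bs hb hBs =>
    have key : ∃ l' : List PlaneTree, (∀ t ∈ l', t.isLeaf = false) ∧ l'.map reduced = l ∧
        l'.flatMap leafBlocks = Bs := by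
      clear hb
      induction l generalizing Bs with
      | nil =>
        cases hBs
        exact ⟨[], by simp⟩
      | cons a l IH =>
        rw [List.flatMap_cons] at hBs
        -- The degrees of the first subtree decide how many of the blocks `Bs` belong to it.
        have h1 := (List.forall₂_take_append _ _ _ hBs.flip).flip
        have h2 := (List.forall₂_drop_append _ _ _ hBs.flip).flip
        obtain ⟨t, ht1, ht2, ht3⟩ := ih a List.mem_cons_self _ h1
        obtain ⟨l', hl1, hl2, hl3⟩ := IH (fun s hs => ih s (List.mem_cons_of_mem _ hs)) h2
        refine ⟨t :: l', ?_, ?_, ?_⟩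
        · simpa using ⟨ht1, hl1⟩
        · rw [List.map_cons, ht2, hl2]
        · rw [List.flatMap_cons, ht3, hl3, List.take_append_drop]
    obtain ⟨l', h1, h2, h3⟩ := key
    obtain ⟨m, hm1, hm2, hm3⟩ := exists_cornerCounts_nonLeaves b l'
      (by rw [hb, ← h2, List.length_map]) h1
    refine ⟨node m, ?_, ?_, ?_⟩
    · rwa [isLeaf_node, List.isEmpty_eq_false_iff]
    · rw [reduced_node, hm3, h2]
    · rw [leafBlocks_node hm1, hm2, hm3, h3]

/-- Every vertex except the root is a child of exactly one vertex. -/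
theorem sum_degrees (t : PlaneTree) : t.degrees.sum + 1 = t.numVertices := by
  induction t using induction_on_children with
  | h l ih =>
    rw [numVertices_node, degrees_node, List.sum_cons, add_comm 1, Nat.add_right_cancel_iff]
    induction l with
    | nil => rfl
    | cons t l IH =>
      have h1 := ih t List.mem_cons_self
      have h2 := IH fun s hs => ih s (List.mem_cons_of_mem _ hs)
      simp only [List.length_cons, List.flatMap_cons, List.sum_append, List.map_cons,
        List.sum_cons] at h2 ⊢
      omega

theorem sum_filter_ne_zero (l : List ℕ) : (l.filter (· ≠ 0)).sum = l.sum := by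
  induction l with
  | nil => rfl
  | cons a l ih =>
    by_cases h : a = 0
    · rw [List.filter_cons_of_neg (by simpa using h), ih, List.sum_cons, h, zero_add]
    · rw [List.filter_cons_of_pos (by simpa using h), List.sum_cons, List.sum_cons, ih]

theorem sum_internalDegrees (t : PlaneTree) : t.internalDegrees.sum + 1 = t.numVertices := by
  rw [← sum_degrees, internalDegrees, sum_filter_ne_zero]

end PlaneTree

/-! ### The mass of a finite tree under the BGW law -/

theorem nil_mem_familyTree (c : List ℕ → ℕ) : [] ∈ familyTree c := by
  intro v j h
  simp at h

theorem cons_mem_familyTree {c : List ℕ → ℕ} {i : ℕ} {u : List ℕ} :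
    i :: u ∈ familyTree c ↔ i < c [] ∧ u ∈ familyTree fun v => c (i :: v) := by
  constructor
  · intro h
    refine ⟨h [] i (by simp), fun v j hv => h (i :: v) j ?_⟩
    rw [List.cons_append, List.cons_prefix_cons]
    exact ⟨rfl, hv⟩
  · rintro ⟨h1, h2⟩ v j hv
    cases v with
    | nil =>
      rw [List.nil_append, List.cons_prefix_cons] at hv
      rwa [hv.1]
    | cons i' v =>
      rw [List.cons_append, List.cons_prefix_cons] at hv
      obtain ⟨rfl, hv⟩ := hv
      exact h2 v j hv

namespace PlaneTree

/-- The number of children of the vertex with address `u` (zero if there is no such vertex). -/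
def degreeAt (t : PlaneTree) (u : List ℕ) : ℕ := (t.subtreeAt u).elim 0 fun s => s.children.length

theorem nil_mem_vertices (t : PlaneTree) : [] ∈ t.vertices := by
  simp [vertices, subtreeAt]

theorem cons_mem_vertices {l : List PlaneTree} {i : ℕ} {u : List ℕ} :
    i :: u ∈ (node l).vertices ↔ ∃ h : i < l.length, u ∈ l[i].vertices := by
  simp only [vertices, Set.mem_ofPred_eq, subtreeAt, children]
  by_cases h : i < l.length
  · simp [h]
  · simp [h]

theorem degreeAt_nil (l : List PlaneTree) : (node l).degreeAt [] = l.length := by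
  simp [degreeAt, subtreeAt, children]

theorem degreeAt_cons {l : List PlaneTree} {i : ℕ} (h : i < l.length) (u : List ℕ) :
    (node l).degreeAt (i :: u) = l[i].degreeAt u := by
  simp [degreeAt, subtreeAt, children, h]

theorem familyTree_eq_vertices_node_iff {c : List ℕ → ℕ} {l : List PlaneTree} :
    familyTree c = (node l).vertices ↔ c [] = l.length ∧
      ∀ i (h : i < l.length), familyTree (fun v => c (i :: v)) = l[i].vertices := by
  constructor
  · intro h
    have h0 : ∀ i, i < c [] ↔ i < l.length := by
      intro i
      have := Set.ext_iff.1 h [i]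
      rw [cons_mem_familyTree, cons_mem_vertices] at this
      simpa [nil_mem_familyTree, nil_mem_vertices] using this
    have h1 : c [] = l.length := le_antisymm (le_of_not_gt fun h => lt_irrefl _ ((h0 _).1 h))
      (le_of_not_gt fun h => lt_irrefl _ ((h0 _).2 h))
    refine ⟨h1, fun i hi => Set.ext fun u => ?_⟩
    have := Set.ext_iff.1 h (i :: u)
    rw [cons_mem_familyTree, cons_mem_vertices, h1] at this
    simpa [hi] using this
  · rintro ⟨h1, h2⟩
    ext u
    cases u with
    | nil => simp [nil_mem_familyTree, nil_mem_vertices]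
    | cons i u =>
      rw [cons_mem_familyTree, cons_mem_vertices, h1]
      constructor
      · rintro ⟨hi, hu⟩
        exact ⟨hi, by rwa [← h2 i hi]⟩
      · rintro ⟨hi, hu⟩
        exact ⟨hi, by rwa [h2 i hi]⟩

/-- This exhibits the event as a cylinder: only the coordinates at the finitely many vertices of `t`
are constrained, so its product measure is a finite product. -/
theorem familyTree_eq_vertices_iff {c : List ℕ → ℕ} {t : PlaneTree} :
    familyTree c = t.vertices ↔ ∀ u ∈ t.vertices, c u = t.degreeAt u := by
  induction t using induction_on_children generalizing c with
  | h l ih =>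
    rw [familyTree_eq_vertices_node_iff]
    constructor
    · rintro ⟨h1, h2⟩ u hu
      cases u with
      | nil => rw [h1, degreeAt_nil]
      | cons i u =>
        obtain ⟨hi, hu⟩ := cons_mem_vertices.1 hu
        rw [degreeAt_cons hi]
        exact (ih l[i] (List.getElem_mem hi)).1 (h2 i hi) u hu
    · intro h
      refine ⟨by rw [h [] (nil_mem_vertices _), degreeAt_nil], fun i hi => ?_⟩
      refine (ih l[i] (List.getElem_mem hi)).2 fun u hu => ?_
      rw [h (i :: u) (cons_mem_vertices.2 ⟨hi, hu⟩), degreeAt_cons hi]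

/-- Passes from products over addresses, natural for the product measure, to products over the
depth-first list of degrees. -/
theorem exists_finset_vertices {M : Type*} [CommMonoid M] (g : ℕ → M) (t : PlaneTree) :
    ∃ V : Finset (List ℕ), (V : Set (List ℕ)) = t.vertices ∧
      ∏ u ∈ V, g (t.degreeAt u) = (t.degrees.map g).prod := by
  classical
  induction t using induction_on_children with
  | h l ih =>
    choose! V hV hg using ih
    let W : Finset (List ℕ) :=
      Finset.univ.biUnion fun i : Fin l.length => (V l[i]).image (List.cons (i : ℕ))
    have hnil : [] ∉ W := by simp [W]
    refine ⟨insert [] W, ?_, ?_⟩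
    · ext u
      cases u with
      | nil => simp [nil_mem_vertices]
      | cons i u =>
        rw [cons_mem_vertices]
        have h1 : ∀ i (h : i < l.length), u ∈ V l[i] ↔ u ∈ l[i].vertices := fun i h => by
          rw [← hV l[i] (List.getElem_mem h), Finset.mem_coe]
        simp only [W, Finset.coe_insert, Set.mem_insert_iff, reduceCtorEq, false_or,
          Finset.mem_coe, Finset.mem_biUnion, Finset.mem_univ, true_and, Finset.mem_image,
          List.cons.injEq]
        constructor
        · rintro ⟨j, v, hv, rfl, rfl⟩
          exact ⟨j.2, (h1 j j.2).1 hv⟩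
        · rintro ⟨hi, hu⟩
          exact ⟨⟨i, hi⟩, u, (h1 i hi).2 hu, rfl, rfl⟩
    · rw [Finset.prod_insert hnil, degreeAt_nil, degrees_node, List.map_cons, List.prod_cons,
        Finset.prod_biUnion]
      · congr 1
        have h2 : ∀ i : Fin l.length, ∏ u ∈ (V l[i]).image (List.cons (i : ℕ)),
            g ((node l).degreeAt u) = (l[i].degrees.map g).prod := by
          intro i
          rw [Finset.prod_image (by simp), ← hg l[i] (List.getElem_mem i.2)]
          exact Finset.prod_congr rfl fun u _ => by rw [degreeAt_cons i.2]; rfl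
        rw [Finset.prod_congr rfl fun i _ => h2 i, List.map_flatMap, List.flatMap_def,
          List.prod_flatten, List.map_map]
        exact Fin.prod_univ_fun_getElem l fun t => (t.degrees.map g).prod
      · intro i _ j _ hij
        rw [Function.onFun, Finset.disjoint_left]
        intro u hu hu'
        simp only [Finset.mem_image] at hu hu'
        obtain ⟨v, _, rfl⟩ := hu
        obtain ⟨w, _, hw⟩ := hu'
        exact hij (Fin.ext (List.cons.inj hw).1.symm)

instance : Countable PlaneTree := by
  rw [← Set.countable_univ_iff]
  have : (Set.univ : Set PlaneTree) = ⋃ k : ℕ, {t | t.numVertices ≤ k} := by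
    ext t
    simpa using ⟨t.numVertices, le_rfl⟩
  rw [this]
  exact Set.countable_iUnion fun k => (finite_numVertices_le k).countable

instance : DiscreteMeasurableSpace PlaneTree := ⟨fun _ => trivial⟩

end PlaneTree

open PlaneTree

theorem bgwLaw_singleton (μ : Measure ℕ) [IsProbabilityMeasure μ] (t : PlaneTree) :
    bgwLaw μ {t} = (t.degrees.map fun d => μ {d}).prod := by
  rw [bgwLaw, Measure.sum_apply _ (.singleton t), tsum_eq_single t]
  · obtain ⟨V, hV, hg⟩ := exists_finset_vertices (fun d => μ {d}) t
    have h : {c : List ℕ → ℕ | familyTree c = t.vertices} =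
        Set.pi V fun u => {t.degreeAt u} := by
      ext c
      rw [Set.mem_ofPred_eq, familyTree_eq_vertices_iff, hV]
      rfl
    rw [h, Measure.smul_apply, Measure.infinitePi_pi _ fun _ _ => .singleton _, hg]
    simp
  · intro τ hτ
    simp [hτ]

/-- The probability that a BGW tree is equal to `t`. -/
theorem bgwLaw_real_singleton (μ : Measure ℕ) [IsProbabilityMeasure μ] (t : PlaneTree) :
    (bgwLaw μ).real {t} = (t.degrees.map fun d => μ.real {d}).prod := by
  rw [Measure.real, bgwLaw_singleton]
  induction t.degrees with
  | nil => simp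
  | cons d l ih => simp [ih, Measure.real]

theorem bgwLaw_singleton_ne_top (μ : Measure ℕ) [IsProbabilityMeasure μ] (t : PlaneTree) :
    bgwLaw μ {t} ≠ ⊤ := by
  rw [bgwLaw_singleton]
  induction t.degrees with
  | nil => simp
  | cons d l ih => simpa using ENNReal.mul_ne_top (measure_ne_top μ {d}) ih

/-- The leaves contribute only through their number, so the mass of a tree depends only on its size
and its internal degrees. -/
theorem prod_map_degrees {M : Type*} [CommMonoid M] (g : ℕ → M) (t : PlaneTree) :
    (t.degrees.map g).prod =
      g 0 ^ (t.numVertices - t.numInternal) * (t.internalDegrees.map g).prod := by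
  rw [numVertices, numInternal, internalDegrees]
  induction t.degrees with
  | nil => simp
  | cons d l ih =>
    by_cases h : d = 0
    · rw [List.filter_cons_of_neg (by simpa using h), List.map_cons, List.prod_cons, ih, h,
        ← mul_assoc, ← pow_succ']
      congr 2
      have := List.length_filter_le (· ≠ 0) l
      simp only [List.length_cons]
      omega
    · rw [List.filter_cons_of_pos (by simpa using h), List.map_cons, List.prod_cons, ih,
        List.map_cons, List.prod_cons, mul_left_comm]
      congr 2
      simp

/-! ### Counting the trees with given reduced tree and internal degrees -/

namespace PlaneTree

theorem getD_flatten_of_forall₂ {D : List ℕ} {B : List (List ℕ)}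
    (h : List.Forall₂ (fun c b => b.length = c + 1) D B) {i m : ℕ} (hi : i < D.length)
    (hm : m < D.getD i 0 + 1) :
    B.flatten.getD (∑ j ∈ Finset.range i, (D.getD j 0 + 1) + m) 0 = (B.getD i []).getD m 0 := by
  induction h generalizing i with
  | nil => simp at hi
  | @cons c b D B hb h ih =>
    rw [List.flatten_cons]
    cases i with
    | zero =>
      rw [List.getD_append _ _ _ _ (by simpa [hb] using hm)]
      simp
    | succ i =>
      rw [Finset.sum_range_succ', List.getD_append_right _ _ _ _ (by simp [hb]; omega)]
      simp only [List.getD_cons_succ, List.getD_cons_zero, List.length_cons] at hi hm ⊢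
      rw [← ih (by omega) hm]
      congr 1
      omega

section Blocks

variable {a t : PlaneTree}

theorem leafBlock_apply (ht : t.isLeaf = false) (ha : t.reduced = a) {i : ℕ}
    (hi : i < a.numVertices) (m : Fin (a.degree i + 1)) :
    leafBlock a i t m = (t.leafBlocks.getD i []).getD m 0 := by
  rw [leafBlock, leafSeq_eq_flatten]
  exact getD_flatten_of_forall₂ (ha ▸ forall₂_degrees_leafBlocks ht) hi m.2

theorem length_getD_leafBlocks (ht : t.isLeaf = false) (ha : t.reduced = a) {i : ℕ}
    (hi : i < a.numVertices) : (t.leafBlocks.getD i []).length = a.degree i + 1 := by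
  have h := forall₂_degrees_leafBlocks ht
  rw [ha] at h
  have hi' : i < t.leafBlocks.length := by rwa [length_leafBlocks ht, ha]
  have := h.get hi hi'
  rw [degree, List.getD_eq_getElem _ _ hi, List.getD_eq_getElem _ _ hi']
  exact this

theorem leafBlocks_eq_ofFn (ht : t.isLeaf = false) (ha : t.reduced = a) :
    t.leafBlocks = List.ofFn fun i : Fin a.numVertices => List.ofFn (leafBlock a i t) := by
  refine List.ext_getElem (by rw [length_leafBlocks ht, ha, List.length_ofFn]) fun i h1 h2 => ?_
  have hi : i < a.numVertices := by simpa using h2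
  have h3 := length_getD_leafBlocks ht ha hi
  rw [List.getD_eq_getElem _ _ h1] at h3
  refine List.ext_getElem (by simp [h3]) fun m h4 h5 => ?_
  simp only [List.getElem_ofFn]
  rw [leafBlock_apply ht ha hi, List.getD_eq_getElem _ _ h1, List.getD_eq_getElem _ _ h4]

theorem ext_of_leafBlock {t' : PlaneTree} (ht : t.isLeaf = false) (ht' : t'.isLeaf = false)
    (ha : t.reduced = a) (ha' : t'.reduced = a)
    (h : ∀ i : Fin a.numVertices, leafBlock a i t = leafBlock a i t') : t = t' := by
  refine ext_of_reduced_of_leafBlocks ht ht' (ha.trans ha'.symm) ?_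
  rw [leafBlocks_eq_ofFn ht ha, leafBlocks_eq_ofFn ht' ha']
  simp_rw [h]

theorem exists_leafBlock (a : PlaneTree)
    (L : (i : Fin a.numVertices) → Fin (a.degree i + 1) → ℕ) :
    ∃ t : PlaneTree, t.isLeaf = false ∧ t.reduced = a ∧
      ∀ i : Fin a.numVertices, leafBlock a i t = L i := by
  obtain ⟨t, ht, ha, hB⟩ := exists_reduced_leafBlocks a (List.ofFn fun i => List.ofFn (L i)) (by
    rw [List.forall₂_iff_get]
    refine ⟨by simp [numVertices], fun i h1 h2 => ?_⟩
    have h3 : a.degree i = a.degrees[i] := List.getD_eq_getElem _ _ h1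
    rw [List.get_eq_getElem, List.get_eq_getElem, List.getElem_ofFn, List.length_ofFn, h3])
  refine ⟨t, ht, ha, fun i => funext fun m => ?_⟩
  have h1 : (List.ofFn fun i => List.ofFn (L i)).getD i [] = List.ofFn (L i) := by
    rw [List.getD_eq_getElem _ _ (by simp), List.getElem_ofFn]
  rw [leafBlock_apply ht ha i.2, hB, h1,
    List.getD_eq_getElem _ _ (by rw [List.length_ofFn]; exact m.2), List.getElem_ofFn]

theorem internalDegree_eq (ht : t.isLeaf = false) (ha : t.reduced = a) {i : ℕ}
    (hi : i < a.numVertices) :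
    t.internalDegree i = max (a.degree i) 1 + ∑ m, leafBlock a i t m := by
  have h1 : i < t.leafBlocks.length := by rwa [length_leafBlocks ht, ha]
  rw [internalDegree, internalDegrees_eq_zipWith ht, ha,
    List.getD_eq_getElem _ _ (by rw [List.length_zipWith]; exact lt_min hi h1),
    List.getElem_zipWith]
  congr 1
  · rw [degree, List.getD_eq_getElem _ _ hi]
    rfl
  · rw [List.getElem_of_eq (leafBlocks_eq_ofFn ht ha), List.getElem_ofFn, List.sum_ofFn]

end Blocks

/-- The trees `t` such that `R(t) = a` and the internal vertices have the numbers of children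
`x 0, x 1, …`. -/
def treesOver {k : ℕ} (a : PlaneTree) (x : Fin k → ℕ) : Set PlaneTree :=
  {t | t.isLeaf = false ∧ t.reduced = a ∧ ∀ j : Fin k, t.internalDegree j = x j}

/-- The possible blocks of leaves around an internal vertex with `x` children, `c` of which are
internal. -/
def blockFinset (c x : ℕ) : Finset (Fin (c + 1) → ℕ) :=
  if max c 1 ≤ x then Finset.piAntidiag Finset.univ (x - max c 1) else ∅

/-- The guard in `blockFinset` is what excludes spurious solutions coming from truncated
subtraction. -/
theorem mem_blockFinset {c x : ℕ} {L : Fin (c + 1) → ℕ} :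
    L ∈ blockFinset c x ↔ x = max c 1 + ∑ m, L m := by
  rw [blockFinset]
  generalize max c 1 = q
  split_ifs with h
  · simp only [Finset.mem_piAntidiag, Finset.mem_univ, implies_true, and_true]
    change ∑ m, L m = x - q ↔ _
    omega
  · simp only [Finset.notMem_empty, false_iff]
    omega

theorem bijOn_treesOver {a : PlaneTree} (x : Fin a.numVertices → ℕ) :
    Set.BijOn (fun t (i : Fin a.numVertices) => leafBlock a i t) (treesOver a x)
      (Fintype.piFinset fun i : Fin a.numVertices => blockFinset (a.degree i) (x i)) := by
  refine ⟨?_, ?_, ?_⟩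
  · rintro t ⟨ht, ha, hx⟩
    simp only [Fintype.coe_piFinset, Set.mem_pi, Set.mem_univ, Finset.mem_coe, mem_blockFinset,
      forall_true_left]
    intro i
    rw [← hx i, internalDegree_eq ht ha i.2]
  · rintro t ⟨ht, ha, -⟩ t' ⟨ht', ha', -⟩ h
    exact ext_of_leafBlock ht ht' ha ha' fun i => congrFun h i
  · intro L hL
    simp only [Fintype.coe_piFinset, Set.mem_pi, Set.mem_univ, Finset.mem_coe, mem_blockFinset,
      forall_true_left] at hL
    obtain ⟨t, ht, ha, h⟩ := exists_leafBlock a L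
    refine ⟨t, ⟨ht, ha, fun i => ?_⟩, funext h⟩
    rw [internalDegree_eq ht ha i.2, hL i, h i]

theorem finite_treesOver {a : PlaneTree} (x : Fin a.numVertices → ℕ) :
    (treesOver a x).Finite :=
  (bijOn_treesOver x).finite_iff_finite.2 (Finset.finite_toSet _)

theorem ncard_treesOver {a : PlaneTree} (x : Fin a.numVertices → ℕ) :
    (treesOver a x).ncard = ∏ i : Fin a.numVertices, (blockFinset (a.degree i) (x i)).card := by
  rw [← Fintype.card_piFinset, ← Set.ncard_coe_finset, ← (bijOn_treesOver x).image_eq,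
    (bijOn_treesOver x).injOn.ncard_image]

/-- In the product of the sets of blocks, fixing the `i`-th coordinate replaces one factor by a
singleton, so all admissible values of that block are taken by equally many trees. -/
theorem ncard_treesOver_inter {a : PlaneTree} (x : Fin a.numVertices → ℕ)
    (i : Fin a.numVertices) {L : Fin (a.degree i + 1) → ℕ}
    (hL : L ∈ blockFinset (a.degree i) (x i)) :
    (treesOver a x ∩ leafBlock a i ⁻¹' {L}).ncard * (blockFinset (a.degree i) (x i)).card =
      (treesOver a x).ncard := by
  classical
  set C : (i : Fin a.numVertices) → Finset (Fin (a.degree i + 1) → ℕ) :=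
    fun i => blockFinset (a.degree i) (x i) with hC
  have h : (fun t (i : Fin a.numVertices) => leafBlock a i t) ''
      (treesOver a x ∩ leafBlock a i ⁻¹' {L}) =
        Fintype.piFinset (Function.update C i {L}) := by
    have h1 : treesOver a x ∩ leafBlock a i ⁻¹' {L} = treesOver a x ∩
        (fun t (i : Fin a.numVertices) => leafBlock a i t) ⁻¹' {y | y i = L} := rfl
    rw [h1, Set.image_inter_preimage, (bijOn_treesOver x).image_eq]
    ext y
    simp only [Set.mem_inter_iff, Finset.mem_coe, Fintype.mem_piFinset, Set.mem_ofPred_eq]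
    constructor
    · rintro ⟨h2, h3⟩ j
      by_cases hj : j = i
      · subst hj
        simpa using h3
      · rw [Function.update_of_ne hj]
        exact h2 j
    · intro h2
      have h3 : y i = L := by simpa using h2 i
      refine ⟨fun j => ?_, h3⟩
      by_cases hj : j = i
      · subst hj
        rwa [h3]
      · simpa [Function.update_of_ne hj] using h2 j
  rw [← ((bijOn_treesOver x).injOn.mono Set.inter_subset_left).ncard_image, h,
    Set.ncard_coe_finset, Fintype.card_piFinset, ncard_treesOver]
  rw [Finset.prod_eq_mul_prod_sdiff_singleton_of_mem (Finset.mem_univ i),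
    Finset.prod_eq_mul_prod_sdiff_singleton_of_mem (Finset.mem_univ i)
      fun i => (blockFinset (a.degree i) (x i)).card]
  rw [Function.update_self, Finset.card_singleton, one_mul, mul_comm]
  congr 1
  refine Finset.prod_congr rfl fun j hj => ?_
  rw [Function.update_of_ne (by simpa using hj)]

/-- Stars and bars with `N = x - max c 1` gives `C(c + N, c)`. For `c ≥ 1` this is `C(x, c)`; for `c
= 0` both numbers are `1`, except at `x = 0`, where no block exists. -/
theorem card_blockFinset (c x : ℕ) :
    (blockFinset c x).card = if x = 0 then 0 else x.choose c := by
  have key : ∀ n : ℕ, (Finset.piAntidiag (Finset.univ : Finset (Fin (c + 1))) n).card =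
      (c + n).choose c := by
    intro n
    have h := Finset.card_finsuppAntidiag_nat_eq_choose (s := (Finset.univ : Finset (Fin (c + 1)))) n
    rw [Finset.card_univ, Fintype.card_fin, show c + 1 + n - 1 = n + c by omega,
      Nat.choose_symm_add, add_comm n] at h
    rw [← h]
    symm
    refine Finset.card_nbij' (fun f => ⇑f) (fun f => Finsupp.equivFunOnFinite.symm f) ?_ ?_ ?_ ?_
    · intro f hf
      simpa using hf
    · intro f hf
      simpa using hf
    · intro f _
      simp
    · intro f _
      simp
  rw [blockFinset]
  split_ifs with h h0 h0
  · omega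
  · rw [key]
    rcases Nat.eq_zero_or_pos c with rfl | hc
    · simp
    · rw [max_eq_left hc] at h ⊢
      rw [Nat.add_sub_cancel' h]
  · rfl
  · rw [Nat.choose_eq_zero_of_lt (by omega), Finset.card_empty]

end PlaneTree

/-! ### From the analytic form of the generating function to a formal differential equation -/

theorem iteratedDeriv_aeval_zero (q : Polynomial ℝ) (i : ℕ) :
    iteratedDeriv i (fun z : ℂ => Polynomial.aeval z q) 0 = i.factorial * (q.coeff i : ℂ) := by
  have h : deriv^[i] (fun z : ℂ => Polynomial.aeval z q) =
      fun z : ℂ => Polynomial.aeval z (Polynomial.derivative^[i] q) := by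
    induction i with
    | zero => rfl
    | succ i ih =>
      rw [Function.iterate_succ_apply', ih, Function.iterate_succ_apply']
      funext z
      simp
  rw [iteratedDeriv_eq_iterate, h]
  simp only [Polynomial.aeval_def, Polynomial.eval₂_at_zero]
  rw [Polynomial.coeff_iterate_derivative, zero_add, Nat.descFactorial_self]
  simp

theorem summable_real_singleton (μ : Measure ℕ) [IsProbabilityMeasure μ] :
    Summable fun n => μ.real {n} := by
  have h : ∑' n, μ {n} ≠ ⊤ := by
    rw [← measure_iUnion (fun i j hij => by simpa using hij) fun i => .singleton i]
    exact measure_ne_top _ _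
  exact ENNReal.summable_toReal h

/-- The generating function of `μ` as a formal power series. -/
noncomputable def genSeries (μ : Measure ℕ) : PowerSeries ℝ := PowerSeries.mk fun n => μ.real {n}

theorem coeff_genSeries (μ : Measure ℕ) (n : ℕ) : PowerSeries.coeff n (genSeries μ) =
    μ.real {n} := by
  rw [genSeries, PowerSeries.coeff_mk]

/-- Agreement on the unit disc suffices: the power series expansion at `0` is unique. -/
theorem factorial_mul_real_singleton_eq_iteratedDeriv (μ : Measure ℕ) [IsProbabilityMeasure μ]
    {G : ℂ → ℂ} (hG : AnalyticAt ℂ G 0) (hμ : ∀ z : ℂ, ‖z‖ ≤ 1 → genFun μ z = G z) (n : ℕ) :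
    iteratedDeriv n G 0 = n.factorial * (μ.real {n} : ℂ) := by
  have h1 : HasFPowerSeriesAt G
      (FormalMultilinearSeries.ofScalars ℂ fun n => (μ.real {n} : ℂ)) 0 := by
    rw [hasFPowerSeriesAt_iff]
    filter_upwards [Metric.ball_mem_nhds (0 : ℂ) one_pos] with z hz
    have hz' : ‖z‖ ≤ 1 := by simpa using (Metric.mem_ball.1 hz).le
    rw [zero_add, ← hμ z hz', genFun]
    have h2 : Summable fun n => (μ.real {n} : ℂ) * z ^ n := by
      refine .of_norm_bounded (summable_real_singleton μ) fun n => ?_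
      rw [norm_mul, norm_pow, Complex.norm_real, Real.norm_of_nonneg measureReal_nonneg]
      exact mul_le_of_le_one_right measureReal_nonneg (pow_le_one₀ (norm_nonneg _) hz')
    simpa only [FormalMultilinearSeries.coeff_ofScalars, smul_eq_mul, mul_comm] using h2.hasSum
  have h3 := hG.hasFPowerSeriesAt.eq_formalMultilinearSeries h1
  have h4 := congrArg (fun p => p.coeff n) h3
  simp only [FormalMultilinearSeries.coeff_ofScalars] at h4
  rw [← h4, mul_div_cancel₀]
  exact_mod_cast n.factorial_ne_zero

/-- The logarithmic derivative of the generating function is a polynomial. -/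
theorem derivative_genSeries (μ : Measure ℕ) [IsProbabilityMeasure μ] (c : ℝ)
    (P : Polynomial ℝ)
    (hμ : ∀ z : ℂ, ‖z‖ ≤ 1 → genFun μ z = c * Complex.exp (Polynomial.aeval z P)) :
    PowerSeries.derivative ℝ (genSeries μ) =
      (Polynomial.derivative P : PowerSeries ℝ) * genSeries μ := by
  set G : ℂ → ℂ := fun z => c * Complex.exp (Polynomial.aeval z P) with hG
  have hderiv : ∀ q : Polynomial ℝ, ∀ z : ℂ, HasDerivAt (fun z : ℂ => Polynomial.aeval z q)
      (Polynomial.aeval z (Polynomial.derivative q)) z := by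
    intro q z
    have := (q.map (algebraMap ℝ ℂ)).hasDerivAt z
    simpa [Polynomial.eval_map_algebraMap, Polynomial.derivative_map] using this
  have hd : ∀ q : Polynomial ℝ, Differentiable ℂ fun z : ℂ => Polynomial.aeval z q :=
    fun q z => (hderiv q z).differentiableAt
  have hGd : Differentiable ℂ G := by
    intro z
    exact ((hd P z).cexp).const_mul _
  have hGa : AnalyticAt ℂ G 0 := hGd.analyticAt 0
  have hdG : deriv G = (fun z : ℂ => Polynomial.aeval z (Polynomial.derivative P)) * G := by
    funext z
    rw [((hderiv P z).cexp.const_mul (c : ℂ)).deriv]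
    simp only [hG, Pi.mul_apply]
    ring
  have hf := factorial_mul_real_singleton_eq_iteratedDeriv μ hGa hμ
  ext n
  rw [PowerSeries.coeff_derivative, PowerSeries.coeff_mul,
    Finset.Nat.sum_antidiagonal_eq_sum_range_succ_mk]
  simp only [genSeries, PowerSeries.coeff_mk, Polynomial.coeff_coe]
  have h1 := hf (n + 1)
  rw [iteratedDeriv_succ', hdG, iteratedDeriv_mul ((hd _).contDiff.contDiffAt)
    (hGd.contDiff.contDiffAt)] at h1
  have h2 : (n.factorial : ℂ) ≠ 0 := by exact_mod_cast n.factorial_ne_zero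
  -- Leibniz's rule for `G' = P' G` at `0`: the binomial coefficients combine with the factorials of
  -- the two derivatives into `n!`, leaving a Cauchy product.
  have h3 : (n.factorial : ℂ) * ∑ i ∈ Finset.range (n + 1),
      ((Polynomial.derivative P).coeff i : ℂ) * (μ.real {n - i} : ℂ) =
      n.factorial * ((μ.real {n + 1} : ℂ) * (n + 1)) := by
    rw [Nat.factorial_succ] at h1
    push_cast at h1
    rw [show (n.factorial : ℂ) * ((μ.real {n + 1} : ℂ) * (n + 1)) =
      (n + 1) * n.factorial * (μ.real {n + 1} : ℂ) by ring, ← h1, Finset.mul_sum]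
    refine Finset.sum_congr rfl fun i hi => ?_
    rw [iteratedDeriv_aeval_zero, hf, ← Nat.choose_mul_factorial_mul_factorial
      (Nat.lt_succ_iff.1 (Finset.mem_range.1 hi))]
    push_cast
    ring
  have h4 := mul_left_cancel₀ h2 h3
  exact_mod_cast h4.symm

/-! ### Variance and positivity from the Euler operator -/

section Concentration

open PowerSeries

/-- The Euler operator `X d/dX` on formal power series. -/
noncomputable def eulerOp (G : PowerSeries ℝ) : PowerSeries ℝ := X * derivative ℝ G

theorem coeff_eulerOp (G : PowerSeries ℝ) (n : ℕ) : coeff n (eulerOp G) = n * coeff n G := by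
  cases n with
  | zero => simp [eulerOp]
  | succ n =>
    rw [eulerOp, coeff_succ_X_mul, coeff_derivative]
    push_cast
    ring

theorem eulerOp_mul (G H : PowerSeries ℝ) : eulerOp (G * H) = eulerOp G * H + G * eulerOp H := by
  simp only [eulerOp, Derivation.leibniz, smul_eq_mul]
  ring

theorem eulerOp_pow (G : PowerSeries ℝ) (n : ℕ) :
    eulerOp (G ^ (n + 1)) = (n + 1) * (eulerOp G * G ^ n) := by
  induction n with
  | zero => simp
  | succ n ih =>
    rw [pow_succ, eulerOp_mul, ih]
    push_cast
    ring

theorem sum_piAntidiag_prod_coeff {k : ℕ} (G : Fin k → PowerSeries ℝ) (m : ℕ) :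
    ∑ x ∈ Finset.piAntidiag Finset.univ m, ∏ i, coeff (x i) (G i) = coeff m (∏ i, G i) := by
  rw [coeff_prod]
  refine Finset.sum_nbij' (fun f => Finsupp.equivFunOnFinite.symm f) (fun f => ⇑f) ?_ ?_ ?_ ?_ ?_
  · intro f hf
    simpa using hf
  · intro f hf
    simpa using hf
  all_goals simp

theorem sum_piAntidiag_prod_coeff_pow (F : PowerSeries ℝ) (k m : ℕ) :
    ∑ x ∈ Finset.piAntidiag (Finset.univ : Finset (Fin k)) m, ∏ i, coeff (x i) F =
      coeff m (F ^ k) := by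
  rw [sum_piAntidiag_prod_coeff]
  simp

/-- A weight depending on one coordinate is absorbed into the corresponding factor of the product;
with Euler operators this yields the moments of that coordinate. -/
theorem sum_piAntidiag_prod_coeff_mul (F : PowerSeries ℝ) {H : PowerSeries ℝ} {h : ℕ → ℝ}
    (hH : ∀ n, coeff n H = h n * coeff n F) (k m : ℕ) (i : Fin (k + 1)) :
    ∑ x ∈ Finset.piAntidiag (Finset.univ : Finset (Fin (k + 1))) m,
      (∏ j, coeff (x j) F) * h (x i) = coeff m (H * F ^ k) := by
  have h1 : ∏ j, Function.update (fun _ : Fin (k + 1) => F) i H j = H * F ^ k := by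
    rw [Finset.prod_update_of_mem (Finset.mem_univ i)]
    simp [Finset.card_sdiff]
  rw [← h1, ← sum_piAntidiag_prod_coeff]
  refine Finset.sum_congr rfl fun x _ => ?_
  rw [Finset.prod_eq_mul_prod_sdiff_singleton_of_mem (Finset.mem_univ i),
    Finset.prod_eq_mul_prod_sdiff_singleton_of_mem (Finset.mem_univ i), Function.update_self, hH]
  have h2 : ∀ j ∈ Finset.univ \ {i},
      coeff (x j) (Function.update (fun _ : Fin (k + 1) => F) i H j) = coeff (x j) F := by
    intro j hj
    rw [Function.update_of_ne (by simpa using hj)]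
  rw [Finset.prod_congr rfl h2]
  ring

/-- A variance bound: conditionally on their sum, independent random variables whose common
generating function has a polynomial logarithm with nonnegative coefficients are concentrated
around their mean. -/
theorem sum_piAntidiag_prod_coeff_mul_sq_le {F P : PowerSeries ℝ} {p : ℕ}
    (hF : ∀ n, 0 ≤ coeff n F) (hP : ∀ n, 0 ≤ coeff n P) (hp : ∀ n, p < n → coeff n P = 0)
    (hFP : eulerOp F = eulerOp P * F) (k m : ℕ) (i : Fin (k + 1)) :
    ∑ x ∈ Finset.piAntidiag (Finset.univ : Finset (Fin (k + 1))) m,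
      (∏ j, coeff (x j) F) * ((x i : ℝ) - m / (k + 1)) ^ 2 ≤ p * m * coeff m (F ^ (k + 1)) := by
  set H := F ^ (k + 1) with hH
  have hHnn : ∀ n, 0 ≤ coeff n H := by
    intro n
    rw [hH, ← sum_piAntidiag_prod_coeff_pow]
    exact Finset.sum_nonneg fun x _ => Finset.prod_nonneg fun i _ => hF _
  have e1 : eulerOp F * F ^ k = eulerOp P * H := by rw [hFP, hH]; ring
  have e2 : eulerOp H = (k + 1) * (eulerOp P * H) := by rw [hH, eulerOp_pow, e1]
  have e3 : eulerOp (eulerOp F) * F ^ k =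
      (eulerOp (eulerOp P) + eulerOp P ^ 2) * H := by
    rw [hFP, eulerOp_mul, hFP, hH]; ring
  have hC : ((k : PowerSeries ℝ) + 1) = C ((k : ℝ) + 1) := by simp
  -- This says that the conditional mean is exactly `m / (k + 1)`.
  have c1 : (m : ℝ) * coeff m H = (k + 1) * coeff m (eulerOp P * H) := by
    rw [← coeff_eulerOp, e2, hC, coeff_C_mul]
  have e4 : eulerOp (eulerOp H) = C ((k : ℝ) + 1) * (eulerOp (eulerOp P) * H) +
      C (((k : ℝ) + 1) ^ 2) * (eulerOp P ^ 2 * H) := by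
    have h0 : eulerOp (C ((k : ℝ) + 1)) = 0 := by simp [eulerOp]
    rw [e2, hC, eulerOp_mul, eulerOp_mul, h0, e2, hC, map_pow]
    ring
  have c2 : (m : ℝ) * (m * coeff m H) = (k + 1) * coeff m (eulerOp (eulerOp P) * H) +
      (k + 1) ^ 2 * coeff m (eulerOp P ^ 2 * H) := by
    rw [← coeff_eulerOp, ← coeff_eulerOp, e4, map_add, coeff_C_mul, coeff_C_mul]
  -- The coefficients `n² P_n` are at most `p n P_n`, since `P_n = 0` for `n > p`.
  have c3 : coeff m (eulerOp (eulerOp P) * H) ≤ p * coeff m (eulerOp P * H) := by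
    rw [coeff_mul, coeff_mul, Finset.mul_sum]
    refine Finset.sum_le_sum fun y _ => ?_
    rw [coeff_eulerOp, coeff_eulerOp, ← mul_assoc (p : ℝ)]
    refine mul_le_mul_of_nonneg_right ?_ (hHnn _)
    rcases le_or_gt y.1 p with h | h
    · exact mul_le_mul_of_nonneg_right (by exact_mod_cast h)
        (mul_nonneg (Nat.cast_nonneg _) (hP _))
    · simp [hp _ h]
  have s0 := sum_piAntidiag_prod_coeff_pow F (k + 1) m
  have s1 := sum_piAntidiag_prod_coeff_mul F (coeff_eulerOp F) k m i
  have s2 := sum_piAntidiag_prod_coeff_mul F (H := eulerOp (eulerOp F))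
    (h := fun n : ℕ => (n : ℝ) * n) (fun n => by rw [coeff_eulerOp, coeff_eulerOp, mul_assoc]) k m i
  rw [e1] at s1
  rw [e3, add_mul, map_add] at s2
  have hk : (0 : ℝ) < k + 1 := by positivity
  have s3 : ∑ x ∈ Finset.piAntidiag (Finset.univ : Finset (Fin (k + 1))) m,
      (∏ j, coeff (x j) F) * ((x i : ℝ) - m / (k + 1)) ^ 2 =
      coeff m (eulerOp (eulerOp P) * H) + coeff m (eulerOp P ^ 2 * H) -
        2 * (m / (k + 1)) * coeff m (eulerOp P * H) + (m / (k + 1)) ^ 2 * coeff m H := by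
    rw [← s1, ← s2, ← s0, Finset.mul_sum, Finset.mul_sum, ← Finset.sum_sub_distrib,
      ← Finset.sum_add_distrib]
    refine Finset.sum_congr rfl fun x _ => ?_
    ring
  rw [s3]
  set A := coeff m (eulerOp (eulerOp P) * H)
  set B := coeff m (eulerOp P ^ 2 * H)
  set E := coeff m (eulerOp P * H)
  set W := coeff m H
  have hE : E = m * W / (k + 1) := by rw [c1]; field_simp
  have hB : B = (m * (m * W) - (k + 1) * A) / (k + 1) ^ 2 := by rw [c2]; field_simp; ring
  have hE0 : 0 ≤ E := by
    rw [hE]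
    exact div_nonneg (mul_nonneg (Nat.cast_nonneg _) (hHnn m)) hk.le
  -- All terms quadratic in `m` cancel; what survives is the unnormalized conditional variance.
  have hval : A + B - 2 * (m / (k + 1)) * E + (m / (k + 1)) ^ 2 * W = A * (k / (k + 1)) := by
    rw [hB, hE]
    field_simp
    ring
  rw [hval]
  have h5 : A * (k / (k + 1)) ≤ p * E * (k / (k + 1)) :=
    mul_le_mul_of_nonneg_right c3 (by positivity)
  -- The bound is deliberately crude: `(k + 1) * E` equals `m * W` by `c1`.
  have h6 : p * E * (k / (k + 1)) ≤ p * E * (k + 1) := by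
    refine mul_le_mul_of_nonneg_left ?_ (mul_nonneg (Nat.cast_nonneg _) hE0)
    rw [div_le_iff₀ hk]
    nlinarith [(Nat.cast_nonneg k : (0 : ℝ) ≤ k)]
  calc A * (k / (k + 1)) ≤ p * E * (k + 1) := h5.trans h6
    _ = p * m * W := by rw [mul_assoc, mul_assoc, c1]; ring

/-- A power series satisfying `θF = (θP) F` with `θ = X d/dX` has eventually positive coefficients
when the indices of the nonzero coefficients of `P` have no common divisor. -/
theorem eventually_coeff_pos {F : PowerSeries ℝ} {P : Polynomial ℝ}
    (hF : ∀ n, 0 ≤ coeff n F) (hF0 : 0 < coeff 0 F) (hP0 : P.coeff 0 = 0)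
    (hP : ∀ n, 0 ≤ P.coeff n) (hgcd : P.support.gcd id = 1)
    (hFP : eulerOp F = eulerOp (P : PowerSeries ℝ) * F) : ∀ᶠ n in atTop, 0 < coeff n F := by
  -- In the identity for `(i + j) F_{i+j}` the convolution has nonnegative terms, one of which is `i
  -- P_i F_j > 0`.
  have step : ∀ i ∈ P.support, ∀ j, 0 < coeff j F → 0 < coeff (i + j) F := by
    intro i hi j hj
    have hPi : 0 < P.coeff i := lt_of_le_of_ne (hP i) (Polynomial.mem_support_iff.1 hi).symm
    have hi0 : 0 < i := Nat.pos_of_ne_zero fun h => by simp [h, hP0] at hPi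
    have h1 : coeff (i + j) (eulerOp F) = ((i + j : ℕ) : ℝ) * coeff (i + j) F := coeff_eulerOp _ _
    have h2 : ∀ n, 0 ≤ coeff n (eulerOp (P : PowerSeries ℝ)) := fun n => by
      rw [coeff_eulerOp, Polynomial.coeff_coe]
      exact mul_nonneg (Nat.cast_nonneg _) (hP n)
    have h3 : coeff i (eulerOp (P : PowerSeries ℝ)) * coeff j F ≤ coeff (i + j) (eulerOp F) := by
      rw [hFP, coeff_mul]
      have hij : (i, j) ∈ Finset.HasAntidiagonal.antidiagonal (i + j) := by simp
      have := Finset.single_le_sum (f := fun y : ℕ × ℕ =>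
        coeff y.1 (eulerOp (P : PowerSeries ℝ)) * coeff y.2 F)
        (fun y _ => mul_nonneg (h2 _) (hF _)) hij
      exact this
    have h4 : 0 < coeff i (eulerOp (P : PowerSeries ℝ)) * coeff j F := by
      rw [coeff_eulerOp, Polynomial.coeff_coe]
      positivity
    rw [h1] at h3
    exact pos_of_mul_pos_right (h4.trans_le h3) (Nat.cast_nonneg (i + j))
  have hclos : ∀ n ∈ AddSubmonoid.closure (P.support : Set ℕ), ∀ j, 0 < coeff j F →
      0 < coeff (n + j) F := by
    intro n hn
    induction hn using AddSubmonoid.closure_induction with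
    | mem i hi => exact step i hi
    | zero => intro j hj; rwa [zero_add]
    | add a b _ _ ha hb => intro j hj; rw [add_assoc]; exact ha _ (hb _ hj)
  -- An additive semigroup of integers contains all large multiples of its gcd, which is `1` here.
  obtain ⟨N, hN⟩ := Nat.exists_mem_closure_of_ge (P.support : Set ℕ)
  filter_upwards [eventually_ge_atTop N] with n hn
  refine hclos n (hN n hn ?_) 0 hF0
  have h1 : Nat.setGcd (P.support : Set ℕ) ∣ 1 := by
    rw [← hgcd]
    exact Finset.dvd_gcd fun i hi => Nat.setGcd_dvd_of_mem hi
  exact h1.trans (one_dvd n)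

end Concentration

/-! ### Equidistribution and limits of conditional means -/

/-- The filter on pairs `(n, x)` along which `n → ∞` and all the ratios `x i / n` tend to `1 / k`. -/
noncomputable def equidistFilter (k : ℕ) : Filter (ℕ × (Fin k → ℕ)) :=
  comap (fun q => (q.1, fun i => (q.2 i : ℝ) / q.1)) (atTop ×ˢ 𝓝 fun _ => (1 / k : ℝ))

theorem tendsto_fst_equidistFilter (k : ℕ) :
    Tendsto (fun q : ℕ × (Fin k → ℕ) => q.1) (equidistFilter k) atTop :=
  (tendsto_comap (f := fun q : ℕ × (Fin k → ℕ) => (q.1, fun i => (q.2 i : ℝ) / q.1))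
    (x := atTop ×ˢ 𝓝 fun _ => (1 / k : ℝ))).fst

theorem tendsto_div_equidistFilter {k : ℕ} (i : Fin k) :
    Tendsto (fun q : ℕ × (Fin k → ℕ) => (q.2 i : ℝ) / q.1) (equidistFilter k) (𝓝 (1 / k)) := by
  have h : Tendsto (fun q : ℕ × (Fin k → ℕ) => fun i => (q.2 i : ℝ) / q.1) (equidistFilter k)
      (𝓝 fun _ => (1 / k : ℝ)) := tendsto_snd.comp tendsto_comap
  exact tendsto_pi_nhds.1 h i

theorem exists_of_mem_equidistFilter {k : ℕ} {S : Set (ℕ × (Fin k → ℕ))}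
    (hS : S ∈ equidistFilter k) : ∃ N : ℕ, ∃ δ : ℝ, 0 < δ ∧ ∀ n ≥ N, ∀ x : Fin k → ℕ,
      (∀ i, |(x i : ℝ) / n - 1 / k| < δ) → (n, x) ∈ S := by
  rw [equidistFilter, mem_comap] at hS
  obtain ⟨T, hT, hTS⟩ := hS
  rw [mem_prod_iff] at hT
  obtain ⟨A, hA, B, hB, hAB⟩ := hT
  obtain ⟨N, hN⟩ := mem_atTop_sets.1 hA
  obtain ⟨δ, hδ, hball⟩ := Metric.mem_nhds_iff.1 hB
  refine ⟨N, δ, hδ, fun n hn x hx => hTS (hAB ⟨hN n hn, hball ?_⟩)⟩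
  rw [Metric.mem_ball, dist_pi_lt_iff hδ]
  intro i
  rw [Real.dist_eq]
  exact hx i

section WeightedMeans

open PowerSeries

variable {F : PowerSeries ℝ}

/-- The mean of `g` under the law of `k` independent random variables with generating function `F`
(up to normalization) conditioned on their sum being `m`. -/
noncomputable def condMean (F : PowerSeries ℝ) (k m : ℕ) (g : (Fin k → ℕ) → ℝ) : ℝ :=
  (∑ x ∈ Finset.piAntidiag Finset.univ m, (∏ j, coeff (x j) F) * g x) / coeff m (F ^ k)

theorem coeff_pow_nonneg (hF : ∀ n, 0 ≤ coeff n F) (k m : ℕ) : 0 ≤ coeff m (F ^ k) := by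
  rw [← sum_piAntidiag_prod_coeff_pow]
  exact Finset.sum_nonneg fun x _ => Finset.prod_nonneg fun i _ => hF _

theorem condMean_mono (hF : ∀ n, 0 ≤ coeff n F) {k m : ℕ} {g h : (Fin k → ℕ) → ℝ}
    (hgh : ∀ x, ∑ i, x i = m → g x ≤ h x) : condMean F k m g ≤ condMean F k m h := by
  refine div_le_div_of_nonneg_right (Finset.sum_le_sum fun x hx => ?_) (coeff_pow_nonneg hF k m)
  refine mul_le_mul_of_nonneg_left (hgh x ?_) (Finset.prod_nonneg fun i _ => hF _)
  exact (Finset.mem_piAntidiag.1 hx).1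

theorem condMean_add (k m : ℕ) (g h : (Fin k → ℕ) → ℝ) :
    condMean F k m (fun x => g x + h x) = condMean F k m g + condMean F k m h := by
  simp only [condMean, mul_add, Finset.sum_add_distrib, add_div]

theorem condMean_const_mul (k m : ℕ) (r : ℝ) (g : (Fin k → ℕ) → ℝ) :
    condMean F k m (fun x => r * g x) = r * condMean F k m g := by
  simp only [condMean, mul_left_comm _ r, ← Finset.mul_sum, mul_div_assoc]

theorem condMean_sum (k m : ℕ) (g : Fin k → (Fin k → ℕ) → ℝ) :
    condMean F k m (fun x => ∑ i, g i x) = ∑ i, condMean F k m (g i) := by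
  simp only [condMean, Finset.mul_sum]
  rw [Finset.sum_comm, Finset.sum_div]

theorem condMean_const {k m : ℕ} (hW : coeff m (F ^ k) ≠ 0) (r : ℝ) :
    condMean F k m (fun _ => r) = r := by
  rw [condMean, ← Finset.sum_mul, sum_piAntidiag_prod_coeff_pow, mul_div_cancel_left₀ _ hW]

/-- The variance bound is centred at `(n - 1) / k`; recentring at `n / k` shifts by `1 / k ≤ 1`, and
`(y - s)² ≤ 2y² + 2s²` pays for it. -/
theorem condMean_sub_sq_le {P : PowerSeries ℝ} {p : ℕ}
    (hF : ∀ n, 0 ≤ coeff n F) (hP : ∀ n, 0 ≤ coeff n P) (hp : ∀ n, p < n → coeff n P = 0)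
    (hFP : eulerOp F = eulerOp P * F) {k n : ℕ} (hn : 1 ≤ n)
    (hW : 0 < coeff (n - 1) (F ^ k)) (i : Fin k) :
    condMean F k (n - 1) (fun x => ((x i : ℝ) / n - 1 / k) ^ 2) ≤ (2 * p + 2) / n := by
  obtain ⟨q, rfl⟩ : ∃ q, k = q + 1 := ⟨k - 1, by have := i.2; omega⟩
  obtain ⟨m, rfl⟩ : ∃ m, n = m + 1 := ⟨n - 1, by omega⟩
  rw [Nat.add_sub_cancel] at hW ⊢
  have hm : (0 : ℝ) < m + 1 := by positivity
  have hq : (1 : ℝ) ≤ q + 1 := by simp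
  have h1 : condMean F (q + 1) m (fun x => ((x i : ℝ) - m / (q + 1)) ^ 2) ≤ p * m := by
    rw [condMean, div_le_iff₀ hW]
    exact sum_piAntidiag_prod_coeff_mul_sq_le hF hP hp hFP q m i
  calc condMean F (q + 1) m (fun x => ((x i : ℝ) / (m + 1 : ℕ) - 1 / (q + 1 : ℕ)) ^ 2)
      ≤ condMean F (q + 1) m (fun x => 2 / (m + 1) ^ 2 * ((x i : ℝ) - m / (q + 1)) ^ 2 +
          2 / (m + 1) ^ 2) := by
        refine condMean_mono hF fun x _ => ?_
        push_cast
        set y : ℝ := (x i : ℝ) - m / (q + 1) with hy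
        have h2 : (x i : ℝ) / (m + 1) - 1 / (q + 1) = (y - 1 / (q + 1)) / (m + 1) := by
          rw [hy]; field_simp; ring
        have h3 : (0 : ℝ) ≤ 1 / (q + 1) := by positivity
        have h4 : (1 : ℝ) / (q + 1) ≤ 1 := by rw [div_le_one (by positivity)]; exact hq
        rw [h2, div_pow, div_mul_eq_mul_div, ← add_div]
        refine div_le_div_of_nonneg_right ?_ (by positivity)
        nlinarith [sq_nonneg (y + 1 / (q + 1))]
    _ = 2 / (m + 1) ^ 2 * condMean F (q + 1) m (fun x => ((x i : ℝ) - m / (q + 1)) ^ 2) +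
          2 / (m + 1) ^ 2 := by
        rw [condMean_add, condMean_const_mul, condMean_const hW.ne']
    _ ≤ 2 / (m + 1) ^ 2 * (p * m) + 2 / (m + 1) ^ 2 := by gcongr
    _ ≤ (2 * p + 2) / (m + 1 : ℕ) := by
        push_cast
        rw [div_mul_eq_mul_div, ← add_div, div_le_div_iff₀ (by positivity) hm]
        have : (0 : ℝ) ≤ p * (m + 1) := by positivity
        have h5 : (0 : ℝ) ≤ m := by positivity
        nlinarith [mul_nonneg this h5]

/-- Bounded functions that converge along the equidistribution filter have convergent conditional
means. -/
theorem tendsto_condMean {P : PowerSeries ℝ} {p : ℕ}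
    (hF : ∀ n, 0 ≤ coeff n F) (hP : ∀ n, 0 ≤ coeff n P) (hp : ∀ n, p < n → coeff n P = 0)
    (hFP : eulerOp F = eulerOp P * F) {k : ℕ}
    (hW : ∀ᶠ n in atTop, 0 < coeff n (F ^ k)) {g : ℕ × (Fin k → ℕ) → ℝ}
    (hg : ∀ n (x : Fin k → ℕ), ∑ i, x i + 1 = n → |g (n, x)| ≤ 1) {L : ℝ}
    (hL : Tendsto g (equidistFilter k) (𝓝 L)) :
    Tendsto (fun n => condMean F k (n - 1) fun x => g (n, x)) atTop (𝓝 L) := by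
  rw [Metric.tendsto_atTop]
  intro η hη
  obtain ⟨N, δ, hδ, hN⟩ := exists_of_mem_equidistFilter (hL (Metric.ball_mem_nhds L (half_pos hη)))
  -- Chosen so that one coordinate at distance at least `δ` from `1 / k` already makes `C` times the
  -- sum of squares exceed the trivial bound `1 + |L|` on `|g - L|`.
  set C : ℝ := (1 + |L|) / δ ^ 2 with hC
  have hC0 : 0 ≤ C := by positivity
  have hlim : Tendsto (fun n : ℕ => C * (k * ((2 * p + 2) / (n : ℝ)))) atTop (𝓝 0) := by
    have h1 : Tendsto (fun n : ℕ => ((2 * p + 2 : ℝ) / (n : ℝ))) atTop (𝓝 0) :=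
      tendsto_const_div_atTop_nhds_zero_nat _
    simpa using (h1.const_mul (k : ℝ)).const_mul C
  obtain ⟨N₁, hN₁⟩ := eventually_atTop.1 (hlim.eventually_lt_const (half_pos hη))
  obtain ⟨N₂, hN₂⟩ := eventually_atTop.1 hW
  refine ⟨max (max N N₁) (N₂ + 1), fun n hn => ?_⟩
  have hn0 : N ≤ n := (le_max_left _ _).trans ((le_max_left _ _).trans hn)
  have hn1 : N₁ ≤ n := (le_max_right _ _).trans ((le_max_left _ _).trans hn)
  have hn2 : N₂ + 1 ≤ n := (le_max_right _ _).trans hn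
  have hWn := hN₂ (n - 1) (by omega)
  set D : (Fin k → ℕ) → ℝ := fun x => η / 2 + C * ∑ i, ((x i : ℝ) / n - 1 / k) ^ 2 with hD
  have hpt : ∀ x : Fin k → ℕ, ∑ i, x i = n - 1 → |g (n, x) - L| ≤ D x := by
    intro x hx
    have hnn : 0 ≤ ∑ i, ((x i : ℝ) / n - 1 / k) ^ 2 := Finset.sum_nonneg fun i _ => sq_nonneg _
    by_cases h : ∀ i, |(x i : ℝ) / n - 1 / k| < δ
    · have h1 := hN n hn0 x h
      rw [Set.mem_preimage, Metric.mem_ball, Real.dist_eq] at h1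
      have := mul_nonneg hC0 hnn
      simp only [hD]
      linarith
    · push Not at h
      obtain ⟨i, hi⟩ := h
      have h1 : δ ^ 2 ≤ ((x i : ℝ) / n - 1 / k) ^ 2 := by
        rw [← sq_abs ((x i : ℝ) / n - 1 / k)]
        exact pow_le_pow_left₀ hδ.le hi 2
      have h2 : ((x i : ℝ) / n - 1 / k) ^ 2 ≤ ∑ i, ((x i : ℝ) / n - 1 / k) ^ 2 :=
        Finset.single_le_sum (f := fun i => ((x i : ℝ) / n - 1 / k) ^ 2)
          (fun i _ => sq_nonneg _) (Finset.mem_univ i)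
      have h3 : 1 + |L| ≤ C * ∑ i, ((x i : ℝ) / n - 1 / k) ^ 2 := by
        rw [hC, div_mul_eq_mul_div, le_div_iff₀ (by positivity)]
        exact mul_le_mul_of_nonneg_left (h1.trans h2) (by positivity)
      have h4 := abs_sub (g (n, x)) L
      have h5 := hg n x (by omega)
      simp only [hD]
      linarith
  have hDmean : condMean F k (n - 1) D < η := by
    have h1 : condMean F k (n - 1) D = η / 2 +
        C * ∑ i, condMean F k (n - 1) (fun x => ((x i : ℝ) / n - 1 / k) ^ 2) := by
      rw [hD, condMean_add, condMean_const hWn.ne', condMean_const_mul, condMean_sum]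
    have h2 : ∑ i : Fin k, condMean F k (n - 1) (fun x => ((x i : ℝ) / n - 1 / k) ^ 2) ≤
        k * ((2 * p + 2) / n) := by
      refine (Finset.sum_le_card_nsmul _ _ _ fun i _ =>
        condMean_sub_sq_le hF hP hp hFP (by omega) hWn i).trans_eq ?_
      simp
    have h3 := hN₁ n hn1
    have h4 := mul_le_mul_of_nonneg_left h2 hC0
    linarith
  have hsub : condMean F k (n - 1) (fun x => g (n, x)) - L =
      condMean F k (n - 1) fun x => g (n, x) - L := by
    have := condMean_add (F := F) k (n - 1) (fun x => g (n, x)) (fun _ => -L)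
    rw [condMean_const hWn.ne'] at this
    simp only [sub_eq_add_neg, this]
  have hup : condMean F k (n - 1) (fun x => g (n, x) - L) ≤ condMean F k (n - 1) D :=
    condMean_mono hF fun x hx => (abs_le.1 (hpt x hx)).2
  have hlo : -condMean F k (n - 1) D ≤ condMean F k (n - 1) (fun x => g (n, x) - L) := by
    have h1 := condMean_const_mul (F := F) k (n - 1) (-1) D
    rw [neg_one_mul] at h1
    rw [← h1]
    exact condMean_mono hF fun x hx => by
      have := (abs_le.1 (hpt x hx)).1
      linarith
  rw [Real.dist_eq, hsub]
  exact (abs_le.2 ⟨hlo, hup⟩).trans_lt hDmean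

end WeightedMeans

/-! ### Asymptotics of the number of trees -/

namespace PlaneTree

theorem card_blockFinset_le (c x : ℕ) : (blockFinset c x).card ≤ x ^ c := by
  rw [card_blockFinset]
  split_ifs
  · exact Nat.zero_le _
  · exact Nat.choose_le_pow x c

/-- The count is a falling factorial over `c!`, and each of its `c` factors `x i - j`, divided by
`n`, tends to `1 / k`. -/
theorem tendsto_card_blockFinset_div {k : ℕ} (i : Fin k) (c : ℕ) :
    Tendsto (fun q : ℕ × (Fin k → ℕ) => ((blockFinset c (q.2 i)).card : ℝ) / q.1 ^ c)
      (equidistFilter k) (𝓝 ((1 / k) ^ c / c.factorial)) := by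
  have hk : (0 : ℝ) < 1 / k := by
    have : 0 < k := i.pos
    positivity
  have hx := tendsto_div_equidistFilter i
  have hn := tendsto_fst_equidistFilter k
  have hpos : ∀ᶠ q in equidistFilter k, 0 < (q.2 i : ℝ) / q.1 := hx.eventually_const_lt hk
  have hdesc : Tendsto (fun q : ℕ × (Fin k → ℕ) => ((q.2 i).descFactorial c : ℝ) / q.1 ^ c)
      (equidistFilter k) (𝓝 ((1 / k) ^ c)) := by
    have hxx : Tendsto (fun q : ℕ × (Fin k → ℕ) => q.2 i) (equidistFilter k) atTop := by
      have h1 : Tendsto (fun q : ℕ × (Fin k → ℕ) => (q.2 i : ℝ)) (equidistFilter k) atTop := by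
        have h2 := (tendsto_natCast_atTop_atTop (R := ℝ)).comp hn
        refine (h2.atTop_mul_pos hk hx).congr' ?_
        filter_upwards [hn.eventually_ge_atTop 1] with q hq
        have : (q.1 : ℝ) ≠ 0 := by positivity
        simp only [Function.comp_apply]
        field_simp
      exact tendsto_natCast_atTop_iff.1 h1
    induction c with
    | zero => simp [tendsto_const_nhds]
    | succ c ih =>
      have h1 : Tendsto (fun q : ℕ × (Fin k → ℕ) => (q.2 i : ℝ) / q.1 - c / q.1)
          (equidistFilter k) (𝓝 (1 / k)) := by
        have := (tendsto_const_div_atTop_nhds_zero_nat (c : ℝ)).comp hn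
        simpa using hx.sub this
      rw [pow_succ]
      refine (ih.mul h1).congr' ?_
      filter_upwards [hxx.eventually_ge_atTop c] with q hq
      rw [Nat.descFactorial_succ, pow_succ]
      push_cast [hq]
      rw [← sub_div, div_mul_div_comm, mul_comm ((q.2 i : ℝ) - c)]
  refine (hdesc.div_const (c.factorial : ℝ)).congr' ?_
  filter_upwards [hpos] with q hq
  have h0 : q.2 i ≠ 0 := by
    intro h
    simp [h] at hq
  rw [card_blockFinset, if_neg h0, Nat.descFactorial_eq_factorial_mul_choose]
  have : (c.factorial : ℝ) ≠ 0 := by exact_mod_cast c.factorial_ne_zero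
  push_cast
  field_simp

/-- The number of the trees with reduced tree `a` whose internal vertices have the numbers of
children `x 0, x 1, …`. -/
noncomputable def treeCount {k : ℕ} (a : PlaneTree) (x : Fin k → ℕ) : ℝ :=
  ∏ i : Fin k, ((blockFinset (a.degree i) (x i)).card : ℝ)

/-- This makes the growth order `n ^ (k - 1)` common to all reduced trees, so that only the
constants `zeta` distinguish them in the limit. -/
theorem sum_degree {k : ℕ} {a : PlaneTree} (ha : a.numVertices = k) :
    ∑ i : Fin k, a.degree i = k - 1 := by
  subst ha
  have h1 := sum_degrees a
  have h2 : ∑ i : Fin a.numVertices, a.degree i = a.degrees.sum := by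
    rw [← Fin.sum_univ_getElem a.degrees]
    refine Finset.sum_congr rfl fun i _ => ?_
    exact List.getD_eq_getElem _ _ i.2
  omega

theorem zeta_eq_prod {k : ℕ} {a : PlaneTree} (ha : a.numVertices = k) :
    a.zeta = ∏ i : Fin k, ((a.degree i).factorial : ℝ)⁻¹ := by
  subst ha
  rw [zeta, Finset.prod_inv_distrib, ← Fin.prod_univ_fun_getElem, Nat.cast_prod]
  congr 1
  refine Finset.prod_congr rfl fun i _ => ?_
  rw [degree, List.getD_eq_getElem _ _ i.2]

theorem treeCount_div_eq_prod {k : ℕ} {a : PlaneTree} (ha : a.numVertices = k) (n : ℕ)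
    (x : Fin k → ℕ) : treeCount a x / (n : ℝ) ^ (k - 1) =
      ∏ i : Fin k, ((blockFinset (a.degree i) (x i)).card : ℝ) / (n : ℝ) ^ a.degree i := by
  rw [Finset.prod_div_distrib, Finset.prod_pow_eq_pow_sum, sum_degree ha, treeCount]

theorem treeCount_nonneg {k : ℕ} (a : PlaneTree) (x : Fin k → ℕ) : 0 ≤ treeCount a x :=
  Finset.prod_nonneg fun _ _ => Nat.cast_nonneg _

theorem treeCount_div_le_one {k : ℕ} {a : PlaneTree} (ha : a.numVertices = k) {n : ℕ}
    {x : Fin k → ℕ} (hx : ∑ i, x i + 1 = n) : treeCount a x / (n : ℝ) ^ (k - 1) ≤ 1 := by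
  rw [treeCount_div_eq_prod ha]
  refine Finset.prod_le_one (fun i _ => by positivity) fun i _ => ?_
  have hn : (0 : ℝ) < n := by
    rw [← hx]
    positivity
  rw [div_le_one (by positivity)]
  have h1 : x i ≤ n := by
    have := Finset.single_le_sum (f := x) (fun _ _ => Nat.zero_le _) (Finset.mem_univ i)
    omega
  calc ((blockFinset (a.degree i) (x i)).card : ℝ) ≤ (x i : ℝ) ^ a.degree i := by
        exact_mod_cast card_blockFinset_le _ _
    _ ≤ (n : ℝ) ^ a.degree i := by gcongr

theorem tendsto_treeCount_div {k : ℕ} {a : PlaneTree} (ha : a.numVertices = k) :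
    Tendsto (fun q : ℕ × (Fin k → ℕ) => treeCount a q.2 / (q.1 : ℝ) ^ (k - 1))
      (equidistFilter k) (𝓝 ((1 / k) ^ (k - 1) * a.zeta)) := by
  have h1 : ((1 / k : ℝ)) ^ (k - 1) * a.zeta =
      ∏ i : Fin k, (1 / k : ℝ) ^ a.degree i / (a.degree i).factorial := by
    rw [zeta_eq_prod ha, ← sum_degree ha, ← Finset.prod_pow_eq_pow_sum, ← Finset.prod_mul_distrib]
    rfl
  simp only [treeCount_div_eq_prod ha]
  rw [h1]
  exact tendsto_finsetProd _ fun i _ => tendsto_card_blockFinset_div i (a.degree i)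

end PlaneTree

/-! ### Probabilities of events as ratios of conditional means -/

open PlaneTree

theorem bgwLaw_ne_top_of_finite (μ : Measure ℕ) [IsProbabilityMeasure μ] {S : Set PlaneTree}
    (hS : S.Finite) : bgwLaw μ S ≠ ⊤ := by
  rw [← hS.coe_toFinset, ← sum_measure_singleton]
  exact ENNReal.sum_ne_top.2 fun t _ => bgwLaw_singleton_ne_top μ t

theorem bgwLaw_ne_top_of_numVertices (μ : Measure ℕ) [IsProbabilityMeasure μ] {S : Set PlaneTree}
    {n : ℕ} (hS : ∀ t ∈ S, t.numVertices = n) : bgwLaw μ S ≠ ⊤ :=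
  bgwLaw_ne_top_of_finite μ ((finite_numVertices_le n).subset fun t ht => (hS t ht).le)

namespace PlaneTree

variable {k : ℕ} {a t : PlaneTree} {x : Fin k → ℕ}

theorem internalDegrees_of_mem_treesOver (ha : a.numVertices = k) (ht : t ∈ treesOver a x) :
    t.internalDegrees = List.ofFn x := by
  obtain ⟨h1, h2, h3⟩ := ht
  have h4 := numInternal_eq_numVertices_reduced h1
  rw [h2, ha] at h4
  refine List.ext_getElem (by rw [List.length_ofFn]; exact h4) fun i hi hi' => ?_
  rw [List.getElem_ofFn, ← h3, internalDegree, List.getD_eq_getElem _ _ hi]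

theorem numInternal_of_mem_treesOver (ha : a.numVertices = k) (ht : t ∈ treesOver a x) :
    t.numInternal = k := by
  rw [numInternal, internalDegrees_of_mem_treesOver ha ht, List.length_ofFn]

theorem numVertices_of_mem_treesOver (ha : a.numVertices = k) (ht : t ∈ treesOver a x) :
    t.numVertices = ∑ i, x i + 1 := by
  rw [← sum_internalDegrees, internalDegrees_of_mem_treesOver ha ht, List.sum_ofFn]

theorem ncard_treesOver_eq_treeCount (ha : a.numVertices = k) :
    ((treesOver a x).ncard : ℝ) = treeCount a x := by
  subst ha
  rw [ncard_treesOver, treeCount]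
  push_cast
  rfl

theorem finite_treesOver_of_numVertices (ha : a.numVertices = k) : (treesOver a x).Finite := by
  subst ha
  exact finite_treesOver x

end PlaneTree

section Events

variable (μ : Measure ℕ) {k : ℕ} {a : PlaneTree}

/-- All trees over `(a, x)` have the same mass, so measuring is counting. -/
theorem bgwLaw_of_subset_treesOver [IsProbabilityMeasure μ] (ha : a.numVertices = k) {x : Fin k → ℕ} {S : Set PlaneTree}
    (hS : S ⊆ treesOver a x) :
    bgwLaw μ S = S.ncard * (μ {0} ^ (∑ i, x i + 1 - k) * ∏ i, μ {x i}) := by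
  have hfin := (finite_treesOver_of_numVertices ha).subset hS
  rw [← hfin.coe_toFinset, ← sum_measure_singleton, Set.ncard_coe_finset, ← nsmul_eq_mul,
    ← Finset.sum_const]
  refine Finset.sum_congr rfl fun t ht => ?_
  have ht' := hS (hfin.mem_toFinset.1 ht)
  rw [bgwLaw_singleton, prod_map_degrees, numInternal_of_mem_treesOver ha ht',
    numVertices_of_mem_treesOver ha ht', internalDegrees_of_mem_treesOver ha ht', List.map_ofFn,
    List.prod_ofFn]
  rfl

theorem bgwLaw_real_treesOver [IsProbabilityMeasure μ] (ha : a.numVertices = k) (x : Fin k → ℕ) :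
    (bgwLaw μ).real (treesOver a x) =
      μ.real {0} ^ (∑ i, x i + 1 - k) * (∏ i, μ.real {x i}) * treeCount a x := by
  rw [Measure.real, bgwLaw_of_subset_treesOver μ ha subset_rfl,
    ← ncard_treesOver_eq_treeCount ha]
  simp only [ENNReal.toReal_mul, ENNReal.toReal_natCast, ENNReal.toReal_pow, ENNReal.toReal_prod]
  rw [mul_comm]
  rfl

/-- The event that the tree has `n` vertices, `k` of which are internal, that the reduced tree is
`a` and that the numbers of children of the internal vertices belong to `U`. -/
def treeEvent (n k : ℕ) (a : PlaneTree) (U : Set (Fin k → ℕ)) : Set PlaneTree :=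
  {t | (t.numVertices = n ∧ t.numInternal = k) ∧ t.reduced = a ∧
    (fun j : Fin k => t.internalDegree j) ∈ U}

open scoped Classical in
theorem treeEvent_eq_biUnion (ha : a.numVertices = k) {n : ℕ} (hn : 1 ≤ n) (hk : 1 ≤ k)
    (U : Set (Fin k → ℕ)) : treeEvent n k a U =
      ⋃ x ∈ (Finset.piAntidiag (Finset.univ : Finset (Fin k)) (n - 1)).filter (· ∈ U),
        treesOver a x := by
  ext t
  simp only [Set.mem_iUnion, Finset.mem_filter, Finset.mem_piAntidiag, exists_prop]
  constructor
  · rintro ⟨⟨h1, h2⟩, h3, h4⟩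
    have ht : t.isLeaf = false := by
      by_contra h
      rw [numInternal_eq_zero_of_isLeaf (by simpa using h)] at h2
      omega
    have hmem : t ∈ treesOver a fun j : Fin k => t.internalDegree j := ⟨ht, h3, fun _ => rfl⟩
    have h5 := numVertices_of_mem_treesOver ha hmem
    refine ⟨_, ⟨⟨?_, by simp⟩, h4⟩, hmem⟩
    omega
  · rintro ⟨x, ⟨⟨h1, -⟩, h2⟩, h3⟩
    change ∑ j, x j = n - 1 at h1
    have h5 := numVertices_of_mem_treesOver ha h3
    have h6 : (fun j : Fin k => t.internalDegree j) = x := funext h3.2.2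
    exact ⟨⟨by omega, numInternal_of_mem_treesOver ha h3⟩, h3.2.1, by rwa [h6]⟩

/-- The normalized weight of `treeEvent n k a U`. -/
noncomputable def eventWeight (n k : ℕ) (a : PlaneTree) (U : Set (Fin k → ℕ)) : ℝ :=
  condMean (genSeries μ) k (n - 1)
    (U.indicator fun x => treeCount a x / (n : ℝ) ^ (k - 1))

/-- The normalization of `eventWeight`. -/
noncomputable def eventNorm (n k : ℕ) : ℝ :=
  μ.real {0} ^ (n - k) * PowerSeries.coeff (n - 1) (genSeries μ ^ k) * (n : ℝ) ^ (k - 1)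

/-- Isolates the factor `eventNorm`, free of `a` and `U`, which cancels after conditioning. -/
theorem bgwLaw_real_treeEvent [IsProbabilityMeasure μ] (ha : a.numVertices = k) {n : ℕ} (hn : 1 ≤ n) (hk : 1 ≤ k)
    (hW : PowerSeries.coeff (n - 1) (genSeries μ ^ k) ≠ 0) (U : Set (Fin k → ℕ)) :
    (bgwLaw μ).real (treeEvent n k a U) = eventNorm μ n k * eventWeight μ n k a U := by
  classical
  have hn0 : (n : ℝ) ^ (k - 1) ≠ 0 := pow_ne_zero _ (by positivity)
  rw [treeEvent_eq_biUnion ha hn hk, measureReal_biUnion_finset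
    (h := fun x _ => bgwLaw_ne_top_of_finite μ (finite_treesOver_of_numVertices ha))]
  · rw [eventNorm, eventWeight, condMean, mul_right_comm _ _ ((n : ℝ) ^ (k - 1)),
      mul_assoc _ (PowerSeries.coeff _ _), mul_div_cancel₀ _ hW, Finset.sum_filter, Finset.mul_sum]
    refine Finset.sum_congr rfl fun x hx => ?_
    have hx' : ∑ i, x i + 1 = n := by
      have := (Finset.mem_piAntidiag.1 hx).1
      change ∑ i, x i = n - 1 at this
      omega
    split_ifs with hU
    · rw [Set.indicator_of_mem hU, bgwLaw_real_treesOver μ ha, hx']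
      simp only [coeff_genSeries]
      field_simp
    · rw [Set.indicator_of_notMem hU, mul_zero, mul_zero]
  · intro x _ y _ hxy
    rw [Function.onFun, Set.disjoint_left]
    intro t h1 h2
    exact hxy (funext fun j => by rw [← h1.2.2 j, h2.2.2 j])
  · intro x _
    exact .of_discrete

/-- The limit ignores `U`: restricting to near-equidistributed degrees costs nothing, hence the
joint convergence. -/
theorem tendsto_eventWeight {P : PowerSeries ℝ} {p : ℕ}
    (hP : ∀ n, 0 ≤ PowerSeries.coeff n P) (hp : ∀ n, p < n → PowerSeries.coeff n P = 0)
    (hFP : eulerOp (genSeries μ) = eulerOp P * genSeries μ)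
    (hW : ∀ᶠ n in atTop, 0 < PowerSeries.coeff n (genSeries μ ^ k))
    (ha : a.numVertices = k) {U : ℕ → Set (Fin k → ℕ)}
    (hU : ∀ᶠ q in equidistFilter k, q.2 ∈ U q.1) :
    Tendsto (fun n => eventWeight μ n k a (U n)) atTop (𝓝 ((1 / k) ^ (k - 1) * a.zeta)) := by
  refine tendsto_condMean (g := fun q => (U q.1).indicator
    (fun x => treeCount a x / (q.1 : ℝ) ^ (k - 1)) q.2) (fun n => ?_) hP hp hFP hW ?_ ?_
  · rw [coeff_genSeries]
    exact measureReal_nonneg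
  · intro n x hx
    have h0 : 0 ≤ treeCount a x / (n : ℝ) ^ (k - 1) :=
      div_nonneg (treeCount_nonneg a x) (by positivity)
    by_cases h : x ∈ U n
    · simp only [Set.indicator_of_mem h, abs_of_nonneg h0]
      exact treeCount_div_le_one ha hx
    · simp [Set.indicator_of_notMem h]
  · refine (tendsto_treeCount_div ha).congr' ?_
    filter_upwards [hU] with q hq
    rw [Set.indicator_of_mem hq]

theorem setOf_numVertices_numInternal_eq_biUnion (hk : 1 ≤ k) (n : ℕ) :
    {t : PlaneTree | t.numVertices = n ∧ t.numInternal = k} =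
      ⋃ b ∈ treesOfSize k, treeEvent n k b Set.univ := by
  ext t
  simp only [Set.mem_iUnion, mem_treesOfSize, exists_prop, treeEvent, Set.mem_ofPred_eq,
    Set.mem_univ, and_true]
  constructor
  · intro h
    have ht : t.isLeaf = false := by
      by_contra hl
      rw [numInternal_eq_zero_of_isLeaf (by simpa using hl)] at h
      omega
    exact ⟨t.reduced, by rw [← numInternal_eq_numVertices_reduced ht, h.2], h, rfl⟩
  · rintro ⟨b, -, h, -⟩
    exact h

theorem bgwLaw_real_numVertices_numInternal [IsProbabilityMeasure μ] {n : ℕ} (hn : 1 ≤ n) (hk : 1 ≤ k)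
    (hW : PowerSeries.coeff (n - 1) (genSeries μ ^ k) ≠ 0) :
    (bgwLaw μ).real {t : PlaneTree | t.numVertices = n ∧ t.numInternal = k} =
      eventNorm μ n k * ∑ b ∈ treesOfSize k, eventWeight μ n k b Set.univ := by
  rw [setOf_numVertices_numInternal_eq_biUnion hk, measureReal_biUnion_finset
    (h := fun b _ => bgwLaw_ne_top_of_numVertices μ fun t ht => ht.1.1), Finset.mul_sum]
  · exact Finset.sum_congr rfl fun b hb =>
      bgwLaw_real_treeEvent μ (mem_treesOfSize.1 hb) hn hk hW _
  · intro b _ b' _ hbb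
    rw [Function.onFun, Set.disjoint_left]
    intro t h1 h2
    exact hbb (h1.2.1.symm.trans h2.2.1)
  · intro b _
    exact .of_discrete

theorem bgwCond_real_eq [IsProbabilityMeasure μ] {n : ℕ} (hn : 1 ≤ n) (hk : 1 ≤ k) (h0 : 0 < μ.real {0})
    (hW : 0 < PowerSeries.coeff (n - 1) (genSeries μ ^ k)) (ha : a.numVertices = k)
    (U : Set (Fin k → ℕ)) :
    (bgwCond μ n k).real {t | t.reduced = a ∧ (fun j : Fin k => t.internalDegree j) ∈ U} =
      eventWeight μ n k a U / ∑ b ∈ treesOfSize k, eventWeight μ n k b Set.univ := by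
  have hN : eventNorm μ n k ≠ 0 := by
    have : (0 : ℝ) < n := by exact_mod_cast hn
    unfold eventNorm
    positivity
  rw [bgwCond, Measure.real, cond_apply .of_discrete, ENNReal.toReal_mul, ENNReal.toReal_inv,
    ← measureReal_def, ← measureReal_def, bgwLaw_real_numVertices_numInternal μ hn hk hW.ne']
  have : {t : PlaneTree | t.numVertices = n ∧ t.numInternal = k} ∩
      {t | t.reduced = a ∧ (fun j : Fin k => t.internalDegree j) ∈ U} = treeEvent n k a U := rfl
  rw [this, bgwLaw_real_treeEvent μ ha hn hk hW.ne', mul_comm, ← div_eq_mul_inv,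
    mul_div_mul_left _ _ hN]

end Events

/-! ### The ingredients of the theorem -/

theorem real_singleton_zero_of_genFun {μ : Measure ℕ} {c : ℝ} {P : Polynomial ℝ}
    (hP0 : P.coeff 0 = 0)
    (hμ : ∀ z : ℂ, ‖z‖ ≤ 1 → genFun μ z = c * Complex.exp (Polynomial.aeval z P)) :
    μ.real {0} = c := by
  have h := hμ 0 (by simp)
  rw [genFun, tsum_eq_single 0 fun n hn => by rw [zero_pow hn, mul_zero], Polynomial.aeval_def,
    Polynomial.eval₂_at_zero, hP0] at h
  simp only [map_zero, Complex.exp_zero, pow_zero, mul_one] at h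
  exact_mod_cast h

theorem eulerOp_genSeries {μ : Measure ℕ} [IsProbabilityMeasure μ] {c : ℝ} {P : Polynomial ℝ}
    (hμ : ∀ z : ℂ, ‖z‖ ≤ 1 → genFun μ z = c * Complex.exp (Polynomial.aeval z P)) :
    eulerOp (genSeries μ) = eulerOp (P : PowerSeries ℝ) * genSeries μ := by
  rw [eulerOp, eulerOp, derivative_genSeries μ c P hμ, PowerSeries.derivative_coe, mul_assoc]

theorem eventually_coeff_pow_pos {F : PowerSeries ℝ} (hF : ∀ n, 0 ≤ PowerSeries.coeff n F)
    (hF0 : 0 < PowerSeries.coeff 0 F) (hpos : ∀ᶠ n in atTop, 0 < PowerSeries.coeff n F)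
    {k : ℕ} (hk : 1 ≤ k) : ∀ᶠ n in atTop, 0 < PowerSeries.coeff n (F ^ k) := by
  filter_upwards [hpos] with n hn
  induction k, hk using Nat.le_induction with
  | base => rwa [pow_one]
  | succ k _ ih =>
    rw [pow_succ, PowerSeries.coeff_mul]
    have hmem : (n, 0) ∈ Finset.HasAntidiagonal.antidiagonal n := by simp
    have := Finset.single_le_sum (f := fun y : ℕ × ℕ =>
      PowerSeries.coeff y.1 (F ^ k) * PowerSeries.coeff y.2 F)
      (fun y _ => mul_nonneg (coeff_pow_nonneg hF k _) (hF _)) hmem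
    exact (mul_pos ih hF0).trans_le this

theorem PlaneTree.zeta_pos (t : PlaneTree) : 0 < t.zeta := by
  rw [zeta_eq_prod rfl]
  exact Finset.prod_pos fun i _ => inv_pos.2 (by exact_mod_cast Nat.factorial_pos _)

theorem PlaneTree.sum_zeta_pos {k : ℕ} (hk : 1 ≤ k) : 0 < ∑ b ∈ treesOfSize k, b.zeta := by
  -- The star shows that trees with `k` vertices exist.
  refine Finset.sum_pos (fun b _ => b.zeta_pos) ⟨node (List.replicate (k - 1) (node [])), ?_⟩
  rw [mem_treesOfSize, numVertices_node, List.map_replicate, List.sum_replicate, numVertices_node]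
  simp
  omega

/-- A Poisson(1) tree equals `b` with probability `e^(-k) ζ(b)`, and `e^(-k)` cancels. -/
theorem bgwCondSize_poissonMeasure_one (k : ℕ) {a : PlaneTree} (ha : a ∈ treesOfSize k) :
    (bgwCondSize (poissonMeasure 1) k).real {a} = a.zeta / ∑ b ∈ treesOfSize k, b.zeta := by
  have h1 : ∀ b ∈ treesOfSize k,
      (bgwLaw (poissonMeasure 1)).real {b} = Real.exp (-1) ^ k * b.zeta := by
    intro b hb
    rw [mem_treesOfSize] at hb
    rw [bgwLaw_real_singleton, zeta_eq_prod hb]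
    subst hb
    rw [← Fin.prod_univ_fun_getElem]
    have h2 : ∀ i : Fin b.degrees.length, (poissonMeasure 1).real {b.degrees[i.1]} =
        Real.exp (-1) * ((b.degree i).factorial : ℝ)⁻¹ := by
      intro i
      rw [poissonMeasure_real_singleton, degree, List.getD_eq_getElem _ _ i.2]
      simp [div_eq_mul_inv]
    rw [Finset.prod_congr rfl fun i _ => h2 i, Finset.prod_mul_distrib, Finset.prod_const,
      Finset.card_univ, Fintype.card_fin]
    rfl
  have h3 : {t : PlaneTree | t.numVertices = k} = ⋃ b ∈ treesOfSize k, {b} := by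
    ext t
    simp [mem_treesOfSize]
  have h4 : (bgwLaw (poissonMeasure 1)).real {t : PlaneTree | t.numVertices = k} =
      Real.exp (-1) ^ k * ∑ b ∈ treesOfSize k, b.zeta := by
    rw [h3, measureReal_biUnion_finset (fun b _ b' _ hbb => by simpa using hbb)
      (fun b _ => .singleton b) (fun b _ => bgwLaw_singleton_ne_top _ b), Finset.mul_sum]
    exact Finset.sum_congr rfl h1
  have h5 : {t : PlaneTree | t.numVertices = k} ∩ {a} = {a} :=
    Set.inter_eq_right.2 (Set.singleton_subset_iff.2 (mem_treesOfSize.1 ha))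
  rw [bgwCondSize, Measure.real, cond_apply .of_discrete, ENNReal.toReal_mul, ENNReal.toReal_inv,
    ← measureReal_def, ← measureReal_def, h4, h5, h1 a ha, mul_comm, ← div_eq_mul_inv,
    mul_div_mul_left _ _ (by positivity)]

theorem map_leafBlock_cond_treesOver (μ : Measure ℕ) [IsProbabilityMeasure μ] {k : ℕ}
    {a : PlaneTree} (ha : a.numVertices = k) {x : Fin k → ℕ}
    (hne : bgwLaw μ (treesOver a x) ≠ 0) (i : Fin k) :
    ((bgwLaw μ)[|treesOver a x]).map (leafBlock a i) =
      uniformOn (blockFinset (a.degree i) (x i) : Set (Fin (a.degree i + 1) → ℕ)) := by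
  classical
  subst ha
  set w := μ {0} ^ (∑ i, x i + 1 - a.numVertices) * ∏ i, μ {x i} with hw
  have hlaw := fun S (hS : S ⊆ treesOver a x) => bgwLaw_of_subset_treesOver μ rfl hS
  have hT := hlaw _ subset_rfl
  rw [← hw] at hT
  rw [hT] at hne
  have hw0 : w ≠ 0 := right_ne_zero_of_mul hne
  have hN0 : (treesOver a x).ncard ≠ 0 := by exact_mod_cast left_ne_zero_of_mul hne
  have hwtop : w ≠ ⊤ := by
    intro h
    refine bgwLaw_ne_top_of_finite μ (finite_treesOver x) ?_
    rw [hT, h, ENNReal.mul_top (left_ne_zero_of_mul hne)]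
  refine Measure.ext_of_singleton fun L => ?_
  rw [Measure.map_apply .of_discrete (.singleton L), cond_apply .of_discrete, hT,
    hlaw _ Set.inter_subset_left, ← hw, ← Finset.coe_singleton, uniformOn_apply_finset]
  by_cases hL : L ∈ blockFinset (a.degree i) (x i)
  · have hM := ncard_treesOver_inter x i hL
    set M := (treesOver a x ∩ leafBlock a i ⁻¹' {L}).ncard with hMdef
    set C := (blockFinset (a.degree i) (x i)).card with hC
    rw [← hM] at hN0 ⊢
    have hM0 : (M : ENNReal) ≠ 0 := by exact_mod_cast left_ne_zero_of_mul hN0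
    have hC0 : (C : ENNReal) ≠ 0 := by exact_mod_cast right_ne_zero_of_mul hN0
    rw [Finset.inter_singleton_of_mem hL, Finset.card_singleton, Nat.cast_one, one_div,
      Finset.coe_singleton, ← hMdef, Nat.cast_mul, mul_right_comm, mul_comm _ (C : ENNReal)]
    have hMw0 : (M : ENNReal) * w ≠ 0 := mul_ne_zero hM0 hw0
    have hMwt : (M : ENNReal) * w ≠ ⊤ := ENNReal.mul_ne_top (ENNReal.natCast_ne_top M) hwtop
    rw [ENNReal.mul_inv (.inl hC0) (.inl (ENNReal.natCast_ne_top C)), mul_assoc,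
      ENNReal.inv_mul_cancel hMw0 hMwt, mul_one]
  · have hempty : treesOver a x ∩ leafBlock a i ⁻¹' {L} = ∅ := by
      rw [Set.eq_empty_iff_forall_notMem]
      rintro t ⟨ht, htL⟩
      refine hL ?_
      rw [← Set.mem_singleton_iff.1 htL, mem_blockFinset, ← ht.2.2 i,
        internalDegree_eq ht.1 ht.2.1 i.2]
    rw [Finset.coe_singleton, hempty, Finset.inter_singleton_of_notMem hL]
    simp

theorem map_leafBlock_bgwCond (μ : Measure ℕ) [IsProbabilityMeasure μ] {n k : ℕ} (hk : 1 ≤ k)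
    {a : PlaneTree} (ha : a.numVertices = k) {x : Fin k → ℕ}
    (hne : bgwCond μ n k {t | t.reduced = a ∧ ∀ j : Fin k, t.internalDegree j = x j} ≠ 0)
    (i : Fin k) :
    ((bgwCond μ n k)[|{t | t.reduced = a ∧ ∀ j : Fin k, t.internalDegree j = x j}]).map
      (leafBlock a i) =
        uniformOn {l : Fin (a.degree i + 1) → ℕ | ∑ m, l m = x i - max (a.degree i) 1} := by
  set S : Set PlaneTree := {t | t.reduced = a ∧ ∀ j : Fin k, t.internalDegree j = x j} with hS
  set E : Set PlaneTree := {t | t.numVertices = n ∧ t.numInternal = k} with hE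
  have hsub : E ∩ S ⊆ treesOver a x := by
    rintro t ⟨⟨-, h2⟩, h3, h4⟩
    refine ⟨?_, h3, h4⟩
    by_contra h
    rw [numInternal_eq_zero_of_isLeaf (by simpa using h)] at h2
    omega
  have hES : bgwLaw μ (E ∩ S) ≠ 0 := by
    intro h
    rw [bgwCond, cond_apply .of_discrete, h, mul_zero] at hne
    exact hne rfl
  obtain ⟨t, ht⟩ := nonempty_of_measure_ne_zero hES
  have htx := hsub ht
  have hn : n = ∑ i, x i + 1 := by
    rw [← ht.1.1]
    exact numVertices_of_mem_treesOver ha htx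
  -- The internal degrees force `n`, so once the event is nonempty the condition on the size is
  -- automatic.
  have heq : E ∩ S = treesOver a x := by
    refine hsub.antisymm fun s hs => ⟨⟨?_, numInternal_of_mem_treesOver ha hs⟩, hs.2⟩
    rw [hn, numVertices_of_mem_treesOver ha hs]
  -- The truncated subtraction is harmless: the witness `t` gives `max (a.degree i) 1 ≤ x i`.
  have hset : {l : Fin (a.degree i + 1) → ℕ | ∑ m, l m = x i - max (a.degree i) 1} =
      blockFinset (a.degree i) (x i) := by
    ext l
    have h := internalDegree_eq htx.1 htx.2.1 (i := i) (by rw [ha]; exact i.2)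
    rw [htx.2.2 i] at h
    rw [Finset.mem_coe, mem_blockFinset, Set.mem_ofPred_eq]
    omega
  rw [bgwCond, cond_cond_eq_cond_inter' .of_discrete .of_discrete
    (bgwLaw_ne_top_of_numVertices μ fun t ht => ht.1), ← hE, heq, hset]
  rw [heq] at hES
  exact map_leafBlock_cond_treesOver μ ha hES i

theorem eventually_forall_abs_sub_lt (k : ℕ) {ε : ℝ} (hε : 0 < ε) :
    ∀ᶠ q in equidistFilter k, ∀ i : Fin k, |(q.2 i : ℝ) / q.1 - 1 / k| < ε := by
  rw [eventually_all]
  intro i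
  filter_upwards [(tendsto_div_equidistFilter i) (Metric.ball_mem_nhds _ hε)] with q hq
  rwa [Set.mem_preimage, Metric.mem_ball, Real.dist_eq] at hq

section

variable {μ : Measure ℕ} [IsProbabilityMeasure μ] {k : ℕ} {P : PowerSeries ℝ} {p : ℕ}

theorem eventually_isProbabilityMeasure_bgwCond
    (hP : ∀ n, 0 ≤ PowerSeries.coeff n P) (hp : ∀ n, p < n → PowerSeries.coeff n P = 0)
    (hFP : eulerOp (genSeries μ) = eulerOp P * genSeries μ) (h0 : 0 < μ.real {0})
    (hW : ∀ᶠ n in atTop, 0 < PowerSeries.coeff n (genSeries μ ^ k)) (hk : 1 ≤ k) :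
    ∀ᶠ n : ℕ in atTop, IsProbabilityMeasure (bgwCond μ n k) := by
  have hlim : Tendsto (fun n => ∑ b ∈ treesOfSize k, eventWeight μ n k b Set.univ) atTop
      (𝓝 (∑ b ∈ treesOfSize k, (1 / k : ℝ) ^ (k - 1) * b.zeta)) :=
    tendsto_finsetSum _ fun b hb => tendsto_eventWeight μ hP hp hFP hW
      (mem_treesOfSize.1 hb) (U := fun _ => Set.univ) (.of_forall fun _ => trivial)
  rw [← Finset.mul_sum] at hlim
  have hk0 : (0 : ℝ) < k := by exact_mod_cast hk
  have hpos := hlim.eventually_const_lt (mul_pos (by positivity) (sum_zeta_pos hk))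
  filter_upwards [hpos, (tendsto_sub_atTop_nat 1).eventually hW, eventually_ge_atTop 1]
    with n hn hWn hn1
  have hN : 0 < eventNorm μ n k := by
    have : (0 : ℝ) < n := by exact_mod_cast hn1
    unfold eventNorm
    positivity
  refine cond_isProbabilityMeasure_of_finite ?_
    (bgwLaw_ne_top_of_numVertices μ (n := n) fun t ht => ht.1)
  intro h
  have h1 := bgwLaw_real_numVertices_numInternal μ hn1 hk hWn.ne'
  rw [Measure.real, h, ENNReal.toReal_zero] at h1
  exact (mul_pos hN hn).ne h1

theorem tendsto_bgwCond_real
    (hP : ∀ n, 0 ≤ PowerSeries.coeff n P) (hp : ∀ n, p < n → PowerSeries.coeff n P = 0)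
    (hFP : eulerOp (genSeries μ) = eulerOp P * genSeries μ) (h0 : 0 < μ.real {0})
    (hW : ∀ᶠ n in atTop, 0 < PowerSeries.coeff n (genSeries μ ^ k)) (hk : 1 ≤ k)
    {a : PlaneTree} (ha : a.numVertices = k) {U : ℕ → Set (Fin k → ℕ)}
    (hU : ∀ᶠ q in equidistFilter k, q.2 ∈ U q.1) :
    Tendsto (fun n : ℕ => (bgwCond μ n k).real
      {t | t.reduced = a ∧ (fun j : Fin k => t.internalDegree j) ∈ U n}) atTop
      (𝓝 (a.zeta / ∑ b ∈ treesOfSize k, b.zeta)) := by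
  have hk0 : (1 / k : ℝ) ^ (k - 1) ≠ 0 := by
    have : (0 : ℝ) < k := by exact_mod_cast hk
    positivity
  have hden : Tendsto (fun n => ∑ b ∈ treesOfSize k, eventWeight μ n k b Set.univ) atTop
      (𝓝 (∑ b ∈ treesOfSize k, (1 / k : ℝ) ^ (k - 1) * b.zeta)) :=
    tendsto_finsetSum _ fun b hb => tendsto_eventWeight μ hP hp hFP hW
      (mem_treesOfSize.1 hb) (U := fun _ => Set.univ) (.of_forall fun _ => trivial)
  rw [← Finset.mul_sum] at hden
  have hlim := (tendsto_eventWeight μ hP hp hFP hW ha hU).div hden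
    (mul_ne_zero hk0 (sum_zeta_pos hk).ne')
  rw [mul_div_mul_left _ _ hk0] at hlim
  refine hlim.congr' ?_
  filter_upwards [(tendsto_sub_atTop_nat 1).eventually hW, eventually_ge_atTop 1] with n hWn hn1
  exact (bgwCond_real_eq μ hn1 hk h0 hWn ha (U n)).symm

end

theorem mainTheorem5 (μ : Measure ℕ) [IsProbabilityMeasure μ] (c : ℝ) (hc : 0 < c)
    (P : Polynomial ℝ) (hP0 : P.coeff 0 = 0) (hP : ∀ j, 0 ≤ P.coeff j)
    (hgcd : P.support.gcd id = 1)
    (hμ : ∀ z : ℂ, ‖z‖ ≤ 1 → genFun μ z = c * Complex.exp (Polynomial.aeval z P))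
    (k : ℕ) (hk : 1 ≤ k) :
    -- the conditioning is non-degenerate for all large `n`
    (∀ᶠ n : ℕ in atTop, IsProbabilityMeasure (bgwCond μ n k)) ∧
    -- the reduced tree converges in distribution to the tree with weights `zeta` ...
    (∀ a ∈ PlaneTree.treesOfSize k,
      Tendsto (fun n : ℕ => (bgwCond μ n k).real {t | t.reduced = a}) atTop
        (𝓝 (a.zeta / ∑ b ∈ PlaneTree.treesOfSize k, b.zeta))) ∧
    -- ... which is a BGW tree with offspring distribution Poisson(1) and `k` vertices
    (∀ a ∈ PlaneTree.treesOfSize k,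
      (bgwCondSize (poissonMeasure 1) k).real {a} =
        a.zeta / ∑ b ∈ PlaneTree.treesOfSize k, b.zeta) ∧
    -- the numbers of children of the internal vertices: convergence in probability ...
    (∀ ε : ℝ, 0 < ε →
      Tendsto (fun n : ℕ => (bgwCond μ n k).real
        {t | ∃ i : Fin k, ε ≤ |(t.internalDegree i : ℝ) / n - 1 / k|}) atTop (𝓝 0)) ∧
    -- ... jointly with the convergence of the reduced tree
    (∀ a ∈ PlaneTree.treesOfSize k, ∀ ε : ℝ, 0 < ε →
      Tendsto (fun n : ℕ => (bgwCond μ n k).real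
        {t | t.reduced = a ∧ ∀ i : Fin k, |(t.internalDegree i : ℝ) / n - 1 / k| < ε}) atTop
        (𝓝 (a.zeta / ∑ b ∈ PlaneTree.treesOfSize k, b.zeta))) ∧
    -- given the reduced tree and these numbers, the leaves around each internal vertex
    (∀ n : ℕ, ∀ a ∈ PlaneTree.treesOfSize k, ∀ x : Fin k → ℕ,
      bgwCond μ n k {t | t.reduced = a ∧ ∀ j : Fin k, t.internalDegree j = x j} ≠ 0 →
      ∀ i : Fin k,
        ((bgwCond μ n k)[|{t | t.reduced = a ∧ ∀ j : Fin k, t.internalDegree j = x j}]).map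
            (PlaneTree.leafBlock a i) =
          uniformOn {l : Fin (a.degree i + 1) → ℕ | ∑ m, l m = x i - max (a.degree i) 1}) := by
  classical
  set F := genSeries μ with hFdef
  have hF : ∀ n, 0 ≤ PowerSeries.coeff n F := fun n => by
    rw [hFdef, coeff_genSeries]
    exact measureReal_nonneg
  have h0 : 0 < μ.real {0} := by rwa [real_singleton_zero_of_genFun hP0 hμ]
  have hF0 : 0 < PowerSeries.coeff 0 F := by rwa [hFdef, coeff_genSeries]
  have hFP := eulerOp_genSeries hμ
  have hW := eventually_coeff_pow_pos hF hF0 (eventually_coeff_pos hF hF0 hP0 hP hgcd hFP) hk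
  have hPc : ∀ n, 0 ≤ PowerSeries.coeff n (P : PowerSeries ℝ) := fun n => by
    rw [Polynomial.coeff_coe]
    exact hP n
  have hPd : ∀ n, P.natDegree < n → PowerSeries.coeff n (P : PowerSeries ℝ) = 0 := fun n hn => by
    rw [Polynomial.coeff_coe, Polynomial.coeff_eq_zero_of_natDegree_lt hn]
  have hprob := eventually_isProbabilityMeasure_bgwCond hPc hPd hFP h0 hW hk
  have hjoint : ∀ a ∈ PlaneTree.treesOfSize k, ∀ ε : ℝ, 0 < ε →
      Tendsto (fun n : ℕ => (bgwCond μ n k).real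
        {t | t.reduced = a ∧ ∀ i : Fin k, |(t.internalDegree i : ℝ) / n - 1 / k| < ε}) atTop
        (𝓝 (a.zeta / ∑ b ∈ PlaneTree.treesOfSize k, b.zeta)) := fun a ha ε hε =>
    tendsto_bgwCond_real hPc hPd hFP h0 hW hk (PlaneTree.mem_treesOfSize.1 ha)
      (U := fun n => {x | ∀ i : Fin k, |(x i : ℝ) / n - 1 / k| < ε})
      (eventually_forall_abs_sub_lt k hε)
  refine ⟨hprob, fun a ha => ?_, fun a ha => bgwCondSize_poissonMeasure_one k ha, fun ε hε => ?_,
    hjoint, fun n a ha x hx i => map_leafBlock_bgwCond μ hk (PlaneTree.mem_treesOfSize.1 ha) hx i⟩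
  · have := tendsto_bgwCond_real hPc hPd hFP h0 hW hk (PlaneTree.mem_treesOfSize.1 ha)
      (U := fun _ => Set.univ) (.of_forall fun _ => trivial)
    simpa using this
  -- The joint limits sum to `1` over the finitely many reduced trees, and the bad event is disjoint
  -- from all the good ones, so no mass is left for it.
  · have hsum : Tendsto (fun n : ℕ => 1 - ∑ a ∈ PlaneTree.treesOfSize k, (bgwCond μ n k).real
        {t | t.reduced = a ∧ ∀ i : Fin k, |(t.internalDegree i : ℝ) / n - 1 / k| < ε}) atTop
        (𝓝 0) := by
      have := (tendsto_finsetSum _ fun a ha => hjoint a ha ε hε).const_sub 1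
      rwa [← Finset.sum_div, div_self (PlaneTree.sum_zeta_pos hk).ne', sub_self] at this
    refine tendsto_of_tendsto_of_tendsto_of_le_of_le' tendsto_const_nhds hsum
      (.of_forall fun n => measureReal_nonneg) ?_
    filter_upwards [hprob] with n hn
    rw [le_sub_iff_add_le, ← measureReal_biUnion_finset, ← measureReal_union (h₂ := measure_ne_top _ _)]
    · exact measureReal_le_one
    · simp only [Set.disjoint_iUnion_right]
      intro a _
      rw [Set.disjoint_left]
      rintro t ⟨i, hi⟩ ⟨-, h⟩
      exact absurd (h i) hi.not_gt
    · exact .of_discrete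
    · intro a _ b _ hab
      rw [Function.onFun, Set.disjoint_left]
      rintro t ⟨h1, -⟩ ⟨h2, -⟩
      exact hab (h1.symm.trans h2)
    · exact fun _ _ => .of_discrete
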